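/- Let $G=(V,E)$ be a countable, locally finite (simple) graph, let $d(x)$ be the degree of $x\in V$, and let $s\colon E\to\{-1,1\}$ be an arbitrary sign function. *Signed voter model.* This is the Feller process $(\eta_t)_{t\ge 0}$ on $\{-1,1\}^V$ whose generator is given, on functions $f$ that depend on finitely many coordinates, by $$\Omega f(\eta)=\sum_{x\in V}\big(f(\eta^x)-f(\eta)\big)\,\frac1{d(x)}\sum_{y:\{x,y\}\in E}\mathbf 1\{\eta(x)\eta(y)\neq s(\{x,y\})\},$$ where $\eta^x$ is $\eta$ with the spin at $x$ flipped (the summand is read as $0$ if $d(x)=0$). It is called *ergodic* if it has exactly one equilibrium (invariant probability measure) $\mu$ and, for every initial configuration $\eta_0\in\{-1,1\}^V$, $\eta_t$ converges in distribution to $\mu$ as $t\to\infty$. *Unsatisfied cycles.* The random walk on $G$ is the continuous-time Markov chain $(X(t))_{t\ge0}$ on $V$ that jumps from $y$ to each neighbour of $y$ at rate $1/d(y)$. For a right-continuous nearest-neighbour step path $\gamma\colon[0,\infty)\to V$ and $0\le a\le b$, the restriction of $\gamma$ to $[a,b]$ is an *unsatisfied cycle* if $\gamma(a)=\gamma(b)$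 and the number of jumps of $\gamma$ in $(a,b]$ along edges of sign $-1$ is odd (sites may be visited several times). The path $\gamma$ *traverses infinitely many unsatisfied cycles* if there are sequences $a_i\to\infty$ and $b_i\to\infty$ such that, for every $i$, the restriction of $\gamma$ to $[a_i,b_i]$ is an unsatisfied cycle. **Proposition.** If for every starting point $x\in V$ the random walk on $G$ started at $x$ traverses infinitely many unsatisfied cycles with probability $1$, then the signed voter model on $G$ with signs $s$ is ergodic. -/

import Mathlib

open MeasureTheory ProbabilityTheory Filter Topology
open scoped NNReal

noncomputable section

namespace SignedVoter

/-! ### Signed nearest neighbour paths -/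

section Paths

variable {V : Type*} (G : SimpleGraph V) (σ : Sym2 V → ℤˣ)

/-- The restriction of `γ` to `[a, b]` is a right-continuous step path that jumps, finitely often,
along edges of `G` only, and the product of the signs of the edges along which it jumps is `ε`.
Here `n` is the number of jumps, `τ 1 < ⋯ < τ n` are the jump times in `(a, b]`, and
`v 0, …, v n` are the sites visited, in this order. The path is even (positive) for `ε = 1`
and odd (negative) for `ε = -1`. -/
def HasSignOn (γ : ℝ≥0 → V) (a b : ℝ≥0) (ε : ℤˣ) : Prop :=
  ∃ (n : ℕ) (τ : ℕ → ℝ≥0) (v : ℕ → V),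
    τ 0 = a ∧ (∀ i < n, τ i < τ (i + 1)) ∧ τ n ≤ b ∧
    (∀ i < n, ∀ u ∈ Set.Ico (τ i) (τ (i + 1)), γ u = v i) ∧
    (∀ u ∈ Set.Icc (τ n) b, γ u = v n) ∧
    (∀ i < n, G.Adj (v i) (v (i + 1))) ∧
    ∏ i ∈ Finset.range n, σ s(v i, v (i + 1)) = ε

/-- `γ` restricted to `[a, b]` is an unsatisfied cycle: a closed nearest neighbour path of
negative sign (which may visit sites several times). -/
def IsUnsatisfiedCycleOn (γ : ℝ≥0 → V) (a b : ℝ≥0) : Prop :=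
  γ a = γ b ∧ HasSignOn G σ γ a b (-1)

/-- The path `γ` traverses infinitely many unsatisfied cycles. -/
def TraversesInfinitelyManyUnsatisfiedCycles (γ : ℝ≥0 → V) : Prop :=
  ∃ a b : ℕ → ℝ≥0, Tendsto a atTop atTop ∧ Tendsto b atTop atTop ∧
    ∀ i, IsUnsatisfiedCycleOn G σ γ (a i) (b i)

end Paths

/-! ### The continuous time simple random walk -/

section Walk

variable {V : Type*} (G : SimpleGraph V) [G.LocallyFinite]
  [MeasurableSpace V] [DiscreteMeasurableSpace V]

open Classical in
/-- One step of the simple random walk: a uniformly chosen neighbour of the present site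
(a walk at an isolated site stays there). -/
def stepKernel : Kernel V V where
  toFun x := if h : (G.neighborFinset x).Nonempty
    then (PMF.uniformOfFinset (G.neighborFinset x) h).toMeasure else Measure.dirac x
  measurable' := Measurable.of_discrete

instance : IsMarkovKernel (stepKernel G) where
  isProbabilityMeasure x := by
    change IsProbabilityMeasure (if h : (G.neighborFinset x).Nonempty
      then (PMF.uniformOfFinset (G.neighborFinset x) h).toMeasure else Measure.dirac x)
    split_ifs <;> infer_instance

/-- The law on `ℕ → V` of the discrete time simple random walk on `G` started at `x`. -/
def chainLaw (x : V) : Measure (ℕ → V) :=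
  Kernel.trajMeasure (X := fun _ => V) (Measure.dirac x) fun n =>
    (stepKernel G).comap (fun h : (Finset.Iic n → V) => h ⟨n, Finset.mem_Iic.2 le_rfl⟩)
      (measurable_pi_apply _)

/-- The joint law of the sites visited and of the holding times, for the continuous time simple
random walk on `G` started at `x` that jumps from `y` to each neighbour of `y` at rate `1 / d(y)`:
the sites form a discrete time simple random walk, and the holding times are independent of it and
i.i.d. exponential of parameter `1`. -/
def walkLaw (x : V) : Measure ((ℕ → V) × (ℕ → ℝ)) :=
  (chainLaw G x).prod (Measure.infinitePi fun _ => expMeasure 1)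

/-- The continuous time path with visited sites `ω.1` and holding times `ω.2`: its site at time `t`
is `ω.1 N`, where `N` is the number of jumps up to time `t`. The `n`-th jump (counted from `0`)
occurs at time `ω.2 0 + ⋯ + ω.2 n`. -/
def walkPath {V : Type*} (ω : (ℕ → V) × (ℕ → ℝ)) (t : ℝ≥0) : V :=
  ω.1 (Set.ncard {n : ℕ | ∑ i ∈ Finset.range (n + 1), ω.2 i ≤ t})

end Walk

/-! ### The signed voter model -/

/-- Every subset of `{-1, 1}` is measurable. -/
instance : DiscreteMeasurableSpace ℤˣ where
  forall_measurableSet s :=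
    ⟨Units.val '' s, MeasurableSet.of_discrete, Set.preimage_image_eq s Units.val_injective⟩

/-- The space `{-1, 1}^V` of spin configurations, with the product topology and σ-algebra. -/
abbrev Config (V : Type*) := V → ℤˣ

section Model

variable {V : Type*}

/-- The configuration that differs from `η` exactly at the site `x`. -/
def flip [DecidableEq V] (η : Config V) (x : V) : Config V := Function.update η x (-η x)

/-- The rate at which the spin at `x` flips when the configuration is `η`: the proportion of
neighbours `y` of `x` with `η x * η y ≠ σ {x, y}`. -/
def flipRate (G : SimpleGraph V) [G.LocallyFinite] (σ : Sym2 V → ℤˣ) (η : Config V) (x : V) : ℝ :=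
  1 / (G.degree x : ℝ) * ∑ y ∈ G.neighborFinset x, if η x * η y ≠ σ s(x, y) then 1 else 0

/-- The operator of the signed voter model (to be applied to functions that depend on finitely many
coordinates, for which only finitely many terms of the sum are nonzero). -/
def pregenerator [DecidableEq V] (G : SimpleGraph V) [G.LocallyFinite] (σ : Sym2 V → ℤˣ)
    (f : Config V → ℝ) (η : Config V) : ℝ :=
  ∑' x, (f (flip η x) - f η) * flipRate G σ η x

/-- `f` depends on finitely many coordinates. -/
def IsCylinder (f : Config V → ℝ) : Prop := ∃ A : Finset V, DependsOn f (A : Set V)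

/-- A family of Markov kernels on `{-1, 1}^V` is a Feller semigroup. -/
structure IsFellerSemigroup (P : ℝ≥0 → Kernel (Config V) (Config V))
    [∀ t, IsMarkovKernel (P t)] : Prop where
  zero : P 0 = Kernel.id
  add : ∀ s t, P (s + t) = P t ∘ₖ P s
  feller : ∀ (t : ℝ≥0) (f : C(Config V, ℝ)), Continuous fun η => ∫ ξ, f ξ ∂(P t η)
  tendsto_zero : ∀ f : C(Config V, ℝ),
    TendstoUniformly (fun (t : ℝ≥0) η => ∫ ξ, f ξ ∂(P t η)) f (𝓝 0)

/-- `P` is the transition semigroup of the signed voter model on the graph `G` with signs `σ`: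
the Feller semigroup whose generator is given by the operator `pregenerator G σ` on functions of
finitely many coordinates. If the process starts from `η`, then `P t η` is its law at time `t`. -/
structure IsSignedVoterModel [DecidableEq V] (G : SimpleGraph V) [G.LocallyFinite]
    (σ : Sym2 V → ℤˣ) (P : ℝ≥0 → Kernel (Config V) (Config V))
    [∀ t, IsMarkovKernel (P t)] : Prop
    extends IsFellerSemigroup P where
  generator : ∀ f : C(Config V, ℝ), IsCylinder f →
    TendstoUniformly (fun (t : ℝ≥0) η => ((∫ ξ, f ξ ∂(P t η)) - f η) / t)
      (pregenerator G σ f) (𝓝[>] 0)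

/-- The law at time `t` of the process with transition semigroup `P` and initial state `η`. -/
def lawAt (P : ℝ≥0 → Kernel (Config V) (Config V)) [∀ t, IsMarkovKernel (P t)]
    (η : Config V) (t : ℝ≥0) : ProbabilityMeasure (Config V) :=
  ⟨P t η, inferInstance⟩

/-- `μ` is an equilibrium of `P`. -/
def IsEquilibrium (P : ℝ≥0 → Kernel (Config V) (Config V))
    (μ : ProbabilityMeasure (Config V)) : Prop :=
  ∀ t, (P t).Invariant (μ : Measure (Config V))

/-- Ergodicity: there is a unique equilibrium, and from every initial configuration the process
converges to it in distribution. -/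
def IsErgodic [Countable V] (P : ℝ≥0 → Kernel (Config V) (Config V))
    [∀ t, IsMarkovKernel (P t)] : Prop :=
  ∃ μ : ProbabilityMeasure (Config V), IsEquilibrium P μ ∧ (∀ ν, IsEquilibrium P ν → ν = μ) ∧
    ∀ η, Tendsto (lawAt P η) atTop (𝓝 μ)

end Model

/-! ### Existence of the signed voter model: the definition above is satisfied by some semigroup -/

section Abstract

variable {B : Type*} [NormedAddCommGroup B] [NormedSpace ℝ B] [CompleteSpace B]

/-- The operator exponential `exp (t A)`. -/
def expOp (A : B →L[ℝ] B) (t : ℝ) : B →L[ℝ] B := NormedSpace.exp (t • A)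

theorem hasSum_exp_apply (A : B →L[ℝ] B) (t : ℝ) (f : B) :
    HasSum (fun k : ℕ => (t ^ k / k.factorial) • (A ^ k) f) (expOp A t f) := by
  rw [expOp]
  have h := NormedSpace.exp_series_hasSum_exp' (𝕂 := ℝ) (t • A)
  have h2 := h.mapL (ContinuousLinearMap.apply ℝ B f)
  refine (h2.congr_fun ?_)
  intro k
  simp [smul_pow, smul_smul, div_eq_inv_mul]

theorem norm_exp_le_one (K : B →L[ℝ] B) (c t : ℝ) (ht : 0 ≤ t) (hK : ‖K‖ ≤ c) :
    ‖expOp (K - c • (1 : B →L[ℝ] B)) t‖ ≤ 1 := by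
  rw [expOp]
  have h1 : t • (K - c • (1 : B →L[ℝ] B)) = t • K + (-(t * c)) • 1 := by
    rw [smul_sub, smul_smul, neg_smul, sub_eq_add_neg]
  have h2 : NormedSpace.exp ((-(t * c)) • (1 : B →L[ℝ] B)) = Real.exp (-(t * c)) • 1 := by
    have := NormedSpace.algebraMap_exp_comm (𝕂 := ℝ) (𝔸 := B →L[ℝ] B) (-(t * c))
    rw [Algebra.algebraMap_eq_smul_one, Algebra.algebraMap_eq_smul_one] at this
    rw [← this, Real.exp_eq_exp_ℝ]
  have hc : Commute (t • K) ((-(t * c)) • (1 : B →L[ℝ] B)) :=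
    (Commute.one_right _).smul_right _
  let _ : NormedAlgebra ℚ (B →L[ℝ] B) := NormedAlgebra.restrictScalars ℚ ℝ _
  rw [h1, NormedSpace.exp_add_of_commute hc, h2, mul_smul_comm, mul_one, norm_smul,
    Real.norm_of_nonneg (Real.exp_nonneg _)]
  have h3 : ‖NormedSpace.exp (t • K)‖ ≤ Real.exp (t * c) := by
    refine ContinuousLinearMap.opNorm_le_bound _ (Real.exp_nonneg _) fun f => ?_
    have hs := hasSum_exp_apply K t f
    rw [expOp] at hs
    have hb : HasSum (fun k : ℕ => (t * c) ^ k / k.factorial * ‖f‖) (Real.exp (t * c) * ‖f‖) := by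
      rw [Real.exp_eq_exp_ℝ]
      exact (NormedSpace.expSeries_div_hasSum_exp (t * c)).mul_right _
    rw [← hs.tsum_eq]
    refine tsum_of_norm_bounded hb fun k => ?_
    rw [norm_smul, Real.norm_of_nonneg (by positivity)]
    have hk : ‖(K ^ k) f‖ ≤ c ^ k * ‖f‖ := by
      induction k with
      | zero => simp
      | succ k ih =>
        rw [pow_succ', mul_apply_eq_comp]
        calc ‖K ((K ^ k) f)‖ ≤ ‖K‖ * ‖(K ^ k) f‖ := K.le_opNorm _
          _ ≤ c * (c ^ k * ‖f‖) := by
            have hc0 : 0 ≤ c := (norm_nonneg K).trans hK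
            gcongr
          _ = c ^ (k + 1) * ‖f‖ := by ring
    calc t ^ k / k.factorial * ‖(K ^ k) f‖ ≤ t ^ k / k.factorial * (c ^ k * ‖f‖) := by gcongr
      _ = (t * c) ^ k / k.factorial * ‖f‖ := by rw [mul_pow]; ring
  calc Real.exp (-(t * c)) * ‖NormedSpace.exp (t • K)‖
      ≤ Real.exp (-(t * c)) * Real.exp (t * c) := by gcongr
    _ = 1 := by rw [← Real.exp_add]; simp

theorem exists_limit_semigroup {I : Type*} [Nonempty I] [SemilatticeSup I] (A : I → B →L[ℝ] B)
    (hA : ∀ i (t : ℝ), 0 ≤ t → ‖expOp (A i) t‖ ≤ 1)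
    (D : Set B) (hD : Dense D)
    (hDA : ∀ f ∈ D, ∃ (C M : ℝ) (a : ℕ → B), 0 ≤ C ∧ 0 ≤ M ∧ (∀ k i, ‖(A i ^ k) f‖ ≤ C * M ^ k) ∧
      ∀ k, ∀ᶠ i in atTop, (A i ^ k) f = a k) :
    ∃ U : ℝ≥0 → B → B,
      (∀ (t : ℝ≥0) f, Tendsto (fun i => expOp (A i) (t : ℝ) f) atTop (𝓝 (U t f))) ∧
      (∀ (t : ℝ≥0) f g, ‖U t f - U t g‖ ≤ ‖f - g‖) ∧
      (∀ s t f, U (s + t) f = U s (U t f)) ∧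
      (∀ f ∈ D, ∀ g, (∀ᶠ i in atTop, A i f = g) → ∃ c, ∀ t : ℝ≥0, t ≤ 1 →
        ‖U t f - f - (t : ℝ) • g‖ ≤ c * (t : ℝ) ^ 2) := by
  have hlip : ∀ i (t : ℝ≥0) f g, ‖expOp (A i) (t : ℝ) f -
      expOp (A i) (t : ℝ) g‖ ≤ ‖f - g‖ := by
    intro i t f g
    rw [← map_sub]
    calc _ ≤ ‖expOp (A i) (t : ℝ)‖ * ‖f - g‖ := ContinuousLinearMap.le_opNorm _ _
      _ ≤ 1 * ‖f - g‖ := by gcongr; exact hA i t t.2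
      _ = _ := one_mul _
  have hconvD : ∀ f ∈ D, ∀ (t : ℝ≥0), ∃ a : ℕ → B, ∃ C M : ℝ, 0 ≤ C ∧ 0 ≤ M ∧
      (∀ k, ‖a k‖ ≤ C * M ^ k) ∧ (∀ k, ∀ᶠ i in atTop, (A i ^ k) f = a k) ∧
      Tendsto (fun i => expOp (A i) (t : ℝ) f) atTop
        (𝓝 (∑' k : ℕ, ((t : ℝ) ^ k / k.factorial) • a k)) := by
    intro f hf t
    obtain ⟨C, M, a, hC, hM, hb, ha⟩ := hDA f hf
    refine ⟨a, C, M, hC, hM, fun k => ?_, ha, ?_⟩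
    · obtain ⟨i, hi⟩ := (ha k).exists
      rw [← hi]; exact hb k i
    · simp_rw [← (hasSum_exp_apply (A _) (t : ℝ) f).tsum_eq]
      refine tendsto_tsum_of_dominated_convergence
        (bound := fun k : ℕ => C * ((t * M) ^ k / k.factorial)) ?_ ?_ ?_
      · exact (Real.summable_pow_div_factorial _).mul_left _
      · intro k
        refine tendsto_const_nhds.congr' ?_
        filter_upwards [ha k] with i hi
        rw [hi]
      · refine Eventually.of_forall fun i k => ?_
        rw [norm_smul, Real.norm_of_nonneg (by positivity)]
        calc (t : ℝ) ^ k / k.factorial * ‖(A i ^ k) f‖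
            ≤ (t : ℝ) ^ k / k.factorial * (C * M ^ k) := by gcongr; exact hb k i
          _ = _ := by rw [mul_pow]; ring
  have hconv : ∀ (t : ℝ≥0) f, ∃ l,
      Tendsto (fun i => expOp (A i) (t : ℝ) f) atTop (𝓝 l) := by
    intro t f
    refine cauchySeq_tendsto_of_complete (Metric.cauchySeq_iff'.2 fun ε hε => ?_)
    obtain ⟨g, hg, hfg⟩ := Metric.dense_iff.1 hD f (ε / 3) (by positivity)
    obtain ⟨a, C, M, -, -, -, -, hl⟩ := hconvD g hfg t
    obtain ⟨N, hN⟩ := Metric.cauchySeq_iff'.1 hl.cauchySeq (ε / 3) (by positivity)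
    refine ⟨N, fun n hn => ?_⟩
    have h1 := hlip n t f g
    have h2 := hlip N t g f
    have h3 := hN n hn
    rw [Metric.mem_ball, dist_eq_norm] at hg
    rw [norm_sub_rev] at hg
    rw [norm_sub_rev g f] at h2
    rw [← dist_eq_norm] at h1 h2 hg
    have := dist_triangle4 (expOp (A n) (t : ℝ) f) (expOp (A n) (t : ℝ) g)
      (expOp (A N) (t : ℝ) g) (expOp (A N) (t : ℝ) f)
    linarith [dist_eq_norm f g]
  choose U hU using hconv
  refine ⟨U, hU, fun t f g => ?_, fun s t f => ?_, fun f hf g hg => ?_⟩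
  · exact le_of_tendsto ((hU t f).sub (hU t g)).norm (Eventually.of_forall fun i => hlip i t f g)
  · refine tendsto_nhds_unique (hU (s + t) f) ?_
    have h1 := hU s (U t f)
    have h2 : Tendsto (fun i => expOp (A i) (s : ℝ) (expOp (A i) (t : ℝ) f)
        - expOp (A i) (s : ℝ) (U t f)) atTop (𝓝 0) := by
      refine squeeze_zero_norm (fun i => hlip i s _ _) ?_
      exact tendsto_iff_norm_sub_tendsto_zero.1 (hU t f)
    have h3 := h2.add h1
    simp only [sub_add_cancel, zero_add] at h3
    refine h3.congr fun i => ?_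
    let _ : NormedAlgebra ℚ (B →L[ℝ] B) := NormedAlgebra.restrictScalars ℚ ℝ _
    rw [expOp, expOp, expOp, NNReal.coe_add, add_smul, NormedSpace.exp_add_of_commute, mul_apply_eq_comp]
    exact ((Commute.refl (A i)).smul_left _).smul_right _
  · obtain ⟨C, M, a, hC, hM, hb, ha⟩ := hDA f hf
    refine ⟨C * M ^ 2 * Real.exp M, fun t ht => ?_⟩
    have key : ∀ i, ‖expOp (A i) (t : ℝ) f - f - (t : ℝ) • A i f‖
        ≤ C * M ^ 2 * Real.exp M * (t : ℝ) ^ 2 := by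
      intro i
      have hs := hasSum_exp_apply (A i) (t : ℝ) f
      rw [← hasSum_nat_add_iff' 2] at hs
      simp only [Finset.sum_range_succ, Finset.sum_range_zero, pow_zero, Nat.factorial_zero,
        Nat.cast_one, div_one, one_smul, one_apply_eq_self, zero_add, pow_one,
        Nat.factorial_one] at hs
      rw [sub_sub, ← hs.tsum_eq]
      have hE : HasSum (fun k : ℕ => C * M ^ 2 * (M ^ k / k.factorial) * (t : ℝ) ^ 2)
          (C * M ^ 2 * Real.exp M * (t : ℝ) ^ 2) := by
        rw [Real.exp_eq_exp_ℝ]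
        exact ((NormedSpace.expSeries_div_hasSum_exp M).mul_left _).mul_right _
      refine tsum_of_norm_bounded hE fun k => ?_
      rw [norm_smul, Real.norm_of_nonneg (by positivity)]
      have ht1 : (t : ℝ) ^ k ≤ 1 := pow_le_one₀ t.2 (by exact_mod_cast ht)
      have hfac : ((k.factorial : ℕ) : ℝ) ≤ ((k + 2).factorial : ℕ) := by
        exact_mod_cast Nat.factorial_le (by omega)
      have hkpos : (0 : ℝ) < k.factorial := by exact_mod_cast Nat.factorial_pos k
      calc (t : ℝ) ^ (k + 2) / (k + 2).factorial * ‖(A i ^ (k + 2)) f‖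
          ≤ (t : ℝ) ^ (k + 2) / k.factorial * (C * M ^ (k + 2)) := by
            gcongr; exact hb _ i
        _ = (t : ℝ) ^ k * (C * M ^ 2 * (M ^ k / k.factorial) * (t : ℝ) ^ 2) := by ring
        _ ≤ 1 * (C * M ^ 2 * (M ^ k / k.factorial) * (t : ℝ) ^ 2) := by gcongr
        _ = _ := one_mul _
    have hlim : Tendsto (fun i => expOp (A i) (t : ℝ) f - f - (t : ℝ) • A i f) atTop
        (𝓝 (U t f - f - (t : ℝ) • g)) := by
      refine ((hU t f).sub_const f).sub (Tendsto.const_smul ?_ _)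
      exact tendsto_const_nhds.congr' (hg.mono fun i hi => hi.symm)
    exact le_of_tendsto hlim.norm (Eventually.of_forall key)

end Abstract

theorem norm_sum_op_le {ι B : Type*} [NormedAddCommGroup B] [NormedSpace ℝ B] (S : Finset ι) (T : ι → B →L[ℝ] B) (c : ι → ℝ)
    (h : ∀ i ∈ S, ‖T i‖ ≤ c i) : ‖∑ i ∈ S, T i‖ ≤ ∑ i ∈ S, c i :=
  norm_sum_le_of_le S h

theorem norm_smul_op_le {B : Type*} [NormedAddCommGroup B] [NormedSpace ℝ B]
    (r : ℝ) (hr : 0 ≤ r) (T : B →L[ℝ] B) (h : ‖T‖ ≤ 1) : ‖r • T‖ ≤ r := by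
  rw [norm_smul, Real.norm_of_nonneg hr]
  exact mul_le_of_le_one_right hr h

section Cylinder

variable {V : Type*}

/-- Composition with a continuous map, as an operator on continuous functions. -/
def compOp (φ : C(Config V, Config V)) : C(Config V, ℝ) →L[ℝ] C(Config V, ℝ) :=
  LinearMap.mkContinuous (ContinuousMap.compRightAlgHom ℝ ℝ φ).toLinearMap 1 fun f => by
    rw [one_mul, ContinuousMap.norm_le _ (norm_nonneg f)]
    exact fun η => f.norm_coe_le_norm (φ η)

theorem compOp_apply (φ : C(Config V, Config V)) (f : C(Config V, ℝ)) (η : Config V) :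
    compOp φ f η = f (φ η) := rfl

theorem norm_compOp_le (φ : C(Config V, Config V)) : ‖compOp φ‖ ≤ 1 :=
  LinearMap.mkContinuous_norm_le _ zero_le_one _

/-- `f` is a sum of functions of at most `n` coordinates whose norms add up to at most `c`. -/
inductive IsCylinderSum (n : ℕ) : ℝ → C(Config V, ℝ) → Prop
  | base (c : ℝ) (f : C(Config V, ℝ)) (A : Finset V) (hA : A.card ≤ n)
      (hf : DependsOn f (A : Set V)) (hc : ‖f‖ ≤ c) : IsCylinderSum n c f
  | add (c d : ℝ) (f g : C(Config V, ℝ)) (hf : IsCylinderSum n c f) (hg : IsCylinderSum n d g) :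
      IsCylinderSum n (c + d) (f + g)

theorem IsCylinderSum.norm_le {n : ℕ} {c : ℝ} {f : C(Config V, ℝ)} (h : IsCylinderSum n c f) :
    ‖f‖ ≤ c := by
  induction h with
  | base c f A hA hf hc => exact hc
  | add c d f g _ _ ihf ihg => exact (norm_add_le _ _).trans (add_le_add ihf ihg)

theorem IsCylinderSum.zero (n : ℕ) {c : ℝ} (hc : 0 ≤ c) :
    IsCylinderSum n c (0 : C(Config V, ℝ)) :=
  .base c 0 ∅ (by simp) (fun _ _ _ => rfl) (by simpa using hc)

theorem IsCylinderSum.mono {n : ℕ} {c d : ℝ} {f : C(Config V, ℝ)} (h : IsCylinderSum n c f)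
    (hcd : c ≤ d) : IsCylinderSum n d f := by
  have := IsCylinderSum.add _ _ _ _ h (IsCylinderSum.zero n (sub_nonneg.2 hcd))
  simpa using this

theorem IsCylinderSum.sum {ι : Type*} {n : ℕ} (S : Finset ι) (c : ι → ℝ)
    (f : ι → C(Config V, ℝ)) (h : ∀ i ∈ S, IsCylinderSum n (c i) (f i)) :
    IsCylinderSum n (∑ i ∈ S, c i) (∑ i ∈ S, f i) := by
  classical
  induction S using Finset.induction_on with
  | empty => simpa using IsCylinderSum.zero n le_rfl
  | insert i S hi ih =>
    rw [Finset.sum_insert hi, Finset.sum_insert hi]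
    exact .add _ _ _ _ (h i (by simp)) (ih fun j hj => h j (by simp [hj]))

/-- The continuous functions that depend on finitely many coordinates. -/
def cylinderSubalgebra (V : Type*) : Subalgebra ℝ C(Config V, ℝ) where
  carrier := {f | IsCylinder f}
  mul_mem' := by
    classical
    rintro f g ⟨A, hA⟩ ⟨B, hB⟩
    refine ⟨A ∪ B, fun η ξ h => ?_⟩
    simp only [ContinuousMap.mul_apply]
    rw [hA fun i hi => h i (by simp_all), hB fun i hi => h i (by simp_all)]
  add_mem' := by
    classical
    rintro f g ⟨A, hA⟩ ⟨B, hB⟩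
    refine ⟨A ∪ B, fun η ξ h => ?_⟩
    simp only [ContinuousMap.add_apply]
    rw [hA fun i hi => h i (by simp_all), hB fun i hi => h i (by simp_all)]
  algebraMap_mem' r := ⟨∅, fun _ _ _ => rfl⟩

theorem dense_cylinder : Dense {f : C(Config V, ℝ) | IsCylinder f} := by
  have h := ContinuousMap.subalgebra_topologicalClosure_eq_top_of_separatesPoints
    (cylinderSubalgebra V) ?_
  · intro f
    have : f ∈ (cylinderSubalgebra V).topologicalClosure := by rw [h]; trivial
    exact this
  · intro η ξ hne
    obtain ⟨x, hx⟩ := Function.ne_iff.1 hne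
    refine ⟨_, ⟨⟨fun ζ => ((ζ x : ℤˣ) : ℝ), ?_⟩, ⟨{x}, fun a b h => ?_⟩, rfl⟩, ?_⟩
    · exact (continuous_of_discreteTopology (f := fun u : ℤˣ => (((u : ℤˣ) : ℤ) : ℝ))).comp
        (continuous_apply x)
    · have : a x = b x := h x (by simp)
      simp [this]
    · simpa [Units.ext_iff] using hx

end Cylinder

section Construction

variable {V : Type*} [DecidableEq V]

/-- The map on configurations by which the spin at `x` becomes `σ {x, y}` times the spin at `y`. -/
def updMap (σ : Sym2 V → ℤˣ) (x y : V) : C(Config V, Config V) where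
  toFun η := Function.update η x (σ s(x, y) * η y)
  continuous_toFun := by
    refine continuous_id.update x ?_
    exact (continuous_of_discreteTopology (f := fun u : ℤˣ => σ s(x, y) * u)).comp
      (continuous_apply y)

variable (G : SimpleGraph V) [G.LocallyFinite] (σ : Sym2 V → ℤˣ)

/-- The part of the generator that updates the spin at `x`. -/
def siteOp (x : V) : C(Config V, ℝ) →L[ℝ] C(Config V, ℝ) :=
  ∑ y ∈ G.neighborFinset x, (1 / (G.degree x : ℝ)) • (compOp (updMap σ x y) - 1)

/-- The part of the generator that updates the spins in the finite set `S`. -/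
def volOp (S : Finset V) : C(Config V, ℝ) →L[ℝ] C(Config V, ℝ) := ∑ x ∈ S, siteOp G σ x

theorem norm_siteOp_add_one_le (x : V) : ‖siteOp G σ x + 1‖ ≤ 1 := by
  by_cases hd : G.degree x = 0
  · have : G.neighborFinset x = ∅ := Finset.card_eq_zero.1 hd
    simp [siteOp, this]
  · have hd' : (G.degree x : ℝ) ≠ 0 := by exact_mod_cast hd
    have : siteOp G σ x + 1 =
        ∑ y ∈ G.neighborFinset x, (1 / (G.degree x : ℝ)) • compOp (updMap σ x y) := by
      simp only [siteOp, smul_sub, Finset.sum_sub_distrib, Finset.sum_const,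
        SimpleGraph.card_neighborFinset_eq_degree]
      rw [← Nat.cast_smul_eq_nsmul ℝ, smul_smul, mul_one_div_cancel hd', one_smul, sub_add_cancel]
    rw [this]
    refine (norm_sum_op_le _ _ (fun _ => 1 / (G.degree x : ℝ)) fun y _ =>
      norm_smul_op_le _ (by positivity) _ (norm_compOp_le _)).trans ?_
    simp [hd']

theorem norm_exp_volOp_le (S : Finset V) (t : ℝ) (ht : 0 ≤ t) :
    ‖expOp (volOp G σ S) t‖ ≤ 1 := by
  have h : volOp G σ S = (∑ x ∈ S, (siteOp G σ x + 1)) -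
      (S.card : ℝ) • (1 : C(Config V, ℝ) →L[ℝ] C(Config V, ℝ)) := by
    rw [Finset.sum_add_distrib, Finset.sum_const, Nat.cast_smul_eq_nsmul, add_sub_cancel_right]
    rfl
  rw [h]
  refine norm_exp_le_one _ _ t ht ((norm_sum_op_le _ _ (fun _ => (1 : ℝ)) fun x _ =>
    norm_siteOp_add_one_le G σ x).trans ?_)
  simp

theorem dependsOn_compOp (x y : V) (A : Finset V) (f : C(Config V, ℝ))
    (hf : DependsOn f (A : Set V)) :
    DependsOn (compOp (updMap σ x y) f) (insert y (A.erase x) : Finset V) := by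
  intro η ξ h
  refine hf fun z hz => ?_
  change Function.update η x _ z = Function.update ξ x _ z
  by_cases hzx : z = x
  · subst hzx
    simp [h y (by simp)]
  · simp only [Function.update_of_ne hzx]
    exact h z (by simpa [hzx] using Or.inr hz)

theorem siteOp_eq_zero (x : V) (A : Finset V) (f : C(Config V, ℝ))
    (hf : DependsOn f (A : Set V)) (hx : x ∉ A) : siteOp G σ x f = 0 := by
  ext η
  have : ∀ y, f (updMap σ x y η) = f η := fun y => hf fun z hz =>
    Function.update_of_ne (by rintro rfl; exact hx hz) _ _
  simp [siteOp, compOp_apply, this, ContinuousMap.sum_apply]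

theorem volOp_eq (A S : Finset V) (f : C(Config V, ℝ)) (hf : DependsOn f (A : Set V)) :
    volOp G σ S f = volOp G σ (S ∩ A) f := by
  simp only [volOp, sum_apply]
  refine (Finset.sum_subset Finset.inter_subset_left fun x hx hxA => ?_).symm
  exact siteOp_eq_zero G σ x A f hf fun h => hxA (Finset.mem_inter.2 ⟨hx, h⟩)

theorem IsCylinderSum.volOp {n : ℕ} {c : ℝ} {f : C(Config V, ℝ)} (h : IsCylinderSum n c f)
    (S : Finset V) : IsCylinderSum n (2 * n * c) (volOp G σ S f) := by
  induction h with
  | add c d f g _ _ ihf ihg =>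
    rw [map_add, mul_add]
    exact .add _ _ _ _ ihf ihg
  | base c f A hA hf hc =>
    have hc0 : 0 ≤ c := (norm_nonneg f).trans hc
    rw [volOp_eq G σ A S f hf]
    simp only [SignedVoter.volOp, sum_apply]
    have h1 : ∀ x ∈ S ∩ A, IsCylinderSum n (2 * c) (siteOp G σ x f) := by
      intro x hx
      have hxA := (Finset.mem_inter.1 hx).2
      simp only [siteOp, sum_apply]
      refine (IsCylinderSum.sum (G.neighborFinset x)
        (fun _ => 1 / (G.degree x : ℝ) * c + 1 / (G.degree x : ℝ) * c) _ fun y _ => ?_).mono ?_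
      · rw [smul_apply, sub_apply, smul_sub,
          sub_eq_add_neg]
        refine .add _ _ _ _ (.base _ _ (insert y (A.erase x)) ?_ ?_ ?_) (.base _ _ A hA ?_ ?_)
        · refine (Finset.card_insert_le _ _).trans ?_
          rw [Finset.card_erase_add_one hxA]
          exact hA
        · intro η ξ hηξ
          simp only [ContinuousMap.smul_apply]
          rw [dependsOn_compOp σ x y A f hf hηξ]
        · rw [norm_smul, Real.norm_of_nonneg (by positivity)]
          gcongr
          exact (((compOp (updMap σ x y)).le_of_opNorm_le (norm_compOp_le _) f).trans
            (one_mul _).le).trans hc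
        · intro η ξ hηξ
          simp [hf hηξ]
        · rw [norm_neg, norm_smul, Real.norm_of_nonneg (by positivity)]
          gcongr
          exact hc
      · rw [Finset.sum_const, SimpleGraph.card_neighborFinset_eq_degree, nsmul_eq_mul]
        by_cases hd : (G.degree x : ℝ) = 0
        · rw [hd]; simpa using hc0
        · field_simp
          linarith
    refine (IsCylinderSum.sum _ _ _ h1).mono ?_
    rw [Finset.sum_const, nsmul_eq_mul]
    have h2 : (((S ∩ A).card : ℕ) : ℝ) ≤ n := by
      exact_mod_cast (Finset.card_le_card Finset.inter_subset_right).trans hA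
    nlinarith

theorem norm_volOp_pow_le (A : Finset V) (f : C(Config V, ℝ)) (hf : DependsOn f (A : Set V))
    (S : Finset V) (k : ℕ) : ‖(volOp G σ S ^ k) f‖ ≤ ‖f‖ * (2 * A.card) ^ k := by
  refine IsCylinderSum.norm_le (n := A.card) ?_
  induction k with
  | zero => simpa using IsCylinderSum.base _ f A le_rfl hf le_rfl
  | succ k ih =>
    have h : (volOp G σ S ^ (k + 1)) f = volOp G σ S ((volOp G σ S ^ k) f) := by
      rw [pow_succ']; rfl
    rw [h]
    exact (IsCylinderSum.volOp G σ ih S).mono (le_of_eq (by ring))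

theorem isCylinder_volOp (S : Finset V) (f : C(Config V, ℝ)) (hf : IsCylinder f) :
    IsCylinder (volOp G σ S f) := by
  change volOp G σ S f ∈ cylinderSubalgebra V
  simp only [volOp, siteOp, sum_apply]
  refine sum_mem fun x _ => sum_mem fun y _ => ?_
  obtain ⟨A, hA⟩ := hf
  refine Subalgebra.smul_mem _ (sub_mem ?_ ?_) _
  · exact ⟨_, dependsOn_compOp σ x y A f hA⟩
  · exact ⟨A, hA⟩

theorem eventually_volOp_eq (A : Finset V) (f : C(Config V, ℝ)) (hf : DependsOn f (A : Set V)) :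
    ∀ᶠ S in atTop, volOp G σ S f = volOp G σ A f := by
  filter_upwards [eventually_ge_atTop A] with S hS
  rw [volOp_eq G σ A S f hf, Finset.inter_eq_right.2 hS]

theorem eventually_volOp_pow_eq (k : ℕ) : ∀ f : C(Config V, ℝ), IsCylinder f →
    ∃ a, ∀ᶠ S in atTop, (volOp G σ S ^ k) f = a := by
  induction k with
  | zero => exact fun f _ => ⟨f, by simp⟩
  | succ k ih =>
    rintro f ⟨A, hA⟩
    obtain ⟨a, ha⟩ := ih _ (isCylinder_volOp G σ A f ⟨A, hA⟩)
    refine ⟨a, ?_⟩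
    filter_upwards [ha, eventually_volOp_eq G σ A f hA] with S h1 h2
    have h3 : (volOp G σ S ^ (k + 1)) f = (volOp G σ S ^ k) (volOp G σ S f) := by
      rw [pow_succ]; rfl
    rw [h3, h2, h1]

theorem update_term_eq (f : Config V → ℝ) (η : Config V) (x y : V) :
    f (updMap σ x y η) - f η =
      (f (flip η x) - f η) * if η x * η y ≠ σ s(x, y) then 1 else 0 := by
  have hy : η y * η y = 1 := Int.units_mul_self _
  by_cases h : η x * η y = σ s(x, y)
  · have h1 : updMap σ x y η = η := by
      change Function.update η x (σ s(x, y) * η y) = η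
      rw [← h, mul_assoc, hy, mul_one, Function.update_eq_self]
    simp [h, h1]
  · have h1 : updMap σ x y η = flip η x := by
      change Function.update η x (σ s(x, y) * η y) = Function.update η x (-η x)
      congr 1
      have h2 : σ s(x, y) = -(η x * η y) :=
        (Int.units_ne_iff_eq_neg.1 (Ne.symm h))
      rw [h2, neg_mul, mul_assoc, hy, mul_one]
    simp [h, h1]

theorem volOp_apply_eq_pregenerator (A : Finset V) (f : C(Config V, ℝ))
    (hf : DependsOn f (A : Set V)) (η : Config V) :
    volOp G σ A f η = pregenerator G σ f η := by
  rw [pregenerator, tsum_eq_sum (s := A)]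
  · simp only [volOp, siteOp, sum_apply, ContinuousMap.sum_apply]
    refine Finset.sum_congr rfl fun x _ => ?_
    rw [flipRate, mul_left_comm, Finset.mul_sum, Finset.mul_sum]
    refine Finset.sum_congr rfl fun y _ => ?_
    rw [← update_term_eq]
    rfl
  · intro x hx
    have : f (flip η x) = f η := hf fun z hz =>
      Function.update_of_ne (by rintro rfl; exact hx hz) _ _
    rw [this, sub_self, zero_mul]

end Construction

section Kernels

variable {V : Type*}

/-- The probability measure that represents a positive normalised functional. -/
theorem exists_measure [Countable V] (Λ : C(Config V, ℝ) →ₗ[ℝ] ℝ) (hpos : ∀ f, 0 ≤ f → 0 ≤ Λ f)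
    (hone : Λ 1 = 1) :
    ∃ μ : Measure (Config V), IsProbabilityMeasure μ ∧ ∀ f : C(Config V, ℝ), ∫ ξ, f ξ ∂μ = Λ f := by
  let L : CompactlySupportedContinuousMap (Config V) ℝ →ₗ[ℝ] ℝ :=
    { toFun := fun f => Λ f.toContinuousMap
      map_add' := fun f g => Λ.map_add f.toContinuousMap g.toContinuousMap
      map_smul' := fun c f => Λ.map_smul c f.toContinuousMap }
  let Lp : CompactlySupportedContinuousMap (Config V) ℝ →ₚ[ℝ] ℝ :=
    PositiveLinearMap.mk₀ L fun f hf => hpos _ hf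
  have hint : ∀ f : C(Config V, ℝ), ∫ ξ, f ξ ∂(RealRMK.rieszMeasure Lp) = Λ f := fun f =>
    RealRMK.integral_rieszMeasure Lp (CompactlySupportedContinuousMap.continuousMapEquiv f)
  refine ⟨RealRMK.rieszMeasure Lp, ⟨?_⟩, hint⟩
  have h := hint 1
  simp only [ContinuousMap.one_apply, integral_const, smul_eq_mul, mul_one, hone] at h
  rw [Measure.real, ENNReal.toReal_eq_one_iff] at h
  exact h

theorem measure_ext_of_continuousMap [Countable V] {μ ν : Measure (Config V)}
    [IsProbabilityMeasure μ] [IsProbabilityMeasure ν]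
    (h : ∀ f : C(Config V, ℝ), ∫ ξ, f ξ ∂μ = ∫ ξ, f ξ ∂ν) : μ = ν :=
  ext_of_forall_integral_eq_of_IsFiniteMeasure fun f => h f.toContinuousMap

theorem measurable_of_feller [Countable V] (μ : Config V → Measure (Config V))
    [∀ η, IsProbabilityMeasure (μ η)]
    (h : ∀ f : C(Config V, ℝ), Continuous fun η => ∫ ξ, f ξ ∂(μ η)) : Measurable μ := by
  refine Measurable.measure_of_isPiSystem_of_isProbabilityMeasure
    (S := measurableCylinders fun _ : V => ℤˣ)
    generateFrom_measurableCylinders.symm isPiSystem_measurableCylinders fun s hs => ?_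
  obtain ⟨A, T, -, rfl⟩ := (mem_measurableCylinders _).1 hs
  have hclopen : IsClopen (cylinder (α := fun _ : V => ℤˣ) A T) :=
    (isClopen_discrete T).preimage (by fun_prop : Continuous (A.restrict (π := fun _ : V => ℤˣ)))
  let f : C(Config V, ℝ) :=
    ⟨(cylinder (α := fun _ : V => ℤˣ) A T).indicator 1, (IsClopen.continuous_indicator hclopen continuous_one)⟩
  have hf : ∀ η, (μ η) (cylinder A T) = ENNReal.ofReal (∫ ξ, f ξ ∂(μ η)) := by
    intro η
    change _ = ENNReal.ofReal (∫ ξ, (cylinder A T).indicator 1 ξ ∂(μ η))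
    rw [integral_indicator_one hclopen.isOpen.measurableSet, ofReal_measureReal]
  simp_rw [hf]
  exact ENNReal.measurable_ofReal.comp (h f).measurable

/-- There is a signed voter model for all signs on every locally finite graph. -/
theorem exists_isSignedVoterModel [Countable V] [DecidableEq V] (G : SimpleGraph V)
    [G.LocallyFinite] (σ : Sym2 V → ℤˣ) :
    ∃ (P : ℝ≥0 → Kernel (Config V) (Config V)) (_ : ∀ t, IsMarkovKernel (P t)),
      IsSignedVoterModel G σ P := by
  obtain ⟨U, hU, hlip, hadd, hgen⟩ := exists_limit_semigroup (volOp G σ)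
    (norm_exp_volOp_le G σ) {f : C(Config V, ℝ) | IsCylinder f} dense_cylinder (by
      rintro f ⟨A, hA⟩
      choose a ha using fun k => eventually_volOp_pow_eq G σ k f ⟨A, hA⟩
      exact ⟨‖f‖, 2 * A.card, a, norm_nonneg _, by positivity,
        fun k S => norm_volOp_pow_le G σ A f hA S k, ha⟩)
  have hUadd : ∀ t f g, U t (f + g) = U t f + U t g := fun t f g =>
    tendsto_nhds_unique (hU t (f + g)) (by simpa using (hU t f).add (hU t g))
  have hUsmul : ∀ t (c : ℝ) f, U t (c • f) = c • U t f := fun t c f =>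
    tendsto_nhds_unique (hU t (c • f)) (by simpa using (hU t f).const_smul c)
  have hcyl0 : ∀ f : C(Config V, ℝ), IsCylinder f →
      Tendsto (fun t => U t f) (𝓝 0) (𝓝 f) := by
    rintro f ⟨A, hA⟩
    obtain ⟨c, hc⟩ := hgen f ⟨A, hA⟩ _ (eventually_volOp_eq G σ A f hA)
    rw [tendsto_iff_norm_sub_tendsto_zero]
    have hlim : Tendsto (fun t : ℝ≥0 => c * (t : ℝ) ^ 2 + (t : ℝ) * ‖volOp G σ A f‖) (𝓝 0)
        (𝓝 0) := by
      have : Continuous fun t : ℝ≥0 => c * (t : ℝ) ^ 2 + (t : ℝ) * ‖volOp G σ A f‖ := by fun_prop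
      simpa using this.tendsto 0
    refine squeeze_zero' (Eventually.of_forall fun _ => norm_nonneg _) ?_ hlim
    filter_upwards [Iic_mem_nhds (zero_lt_one (α := ℝ≥0))] with t ht
    have h1 : U t f - f = (U t f - f - (t : ℝ) • volOp G σ A f) + (t : ℝ) • volOp G σ A f := by
      abel
    rw [h1]
    refine (norm_add_le _ _).trans (add_le_add (hc t ht) ?_)
    rw [norm_smul, Real.norm_of_nonneg t.coe_nonneg]
  have hcont0 : ∀ f, Tendsto (fun t => U t f) (𝓝 0) (𝓝 f) := by
    intro f
    rw [Metric.tendsto_nhds]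
    intro ε hε
    obtain ⟨g, hg, hfg⟩ := Metric.dense_iff.1 dense_cylinder f (ε / 3) (by positivity)
    filter_upwards [Metric.tendsto_nhds.1 (hcyl0 g hfg) (ε / 3) (by positivity)] with t ht
    have h1 := hlip t f g
    rw [← dist_eq_norm, ← dist_eq_norm] at h1
    rw [Metric.mem_ball] at hg
    have := dist_triangle4 (U t f) (U t g) g f
    rw [dist_comm f g] at h1
    linarith
  have hU0 : ∀ f, U 0 f = f := fun f => by
    refine tendsto_nhds_unique (hU 0 f) ?_
    simp [expOp]
  have hUone : ∀ t, U t 1 = 1 := fun t => by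
    refine tendsto_nhds_unique (hU t 1) (tendsto_const_nhds.congr fun S => ?_)
    have h1 : volOp G σ S 1 = 0 := by
      rw [volOp_eq G σ ∅ S 1 (fun _ _ _ => rfl)]
      simp [volOp]
    have h3 := hasSum_single (f := fun k : ℕ => ((t : ℝ) ^ k / k.factorial) • (volOp G σ S ^ k) 1)
      0 fun k hk => by
        obtain ⟨j, rfl⟩ := Nat.exists_eq_succ_of_ne_zero hk
        have h2 : (volOp G σ S ^ (j + 1)) 1 = (volOp G σ S ^ j) (volOp G σ S 1) := by
          rw [pow_succ]; rfl
        rw [Nat.succ_eq_add_one, h2, h1, map_zero, smul_zero]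
    rw [← h3.unique (hasSum_exp_apply (volOp G σ S) (t : ℝ) 1)]
    simp
  have hUpos : ∀ t f, 0 ≤ f → 0 ≤ U t f := by
    intro t f hf η
    have h1 : ‖‖f‖ • (1 : C(Config V, ℝ)) - f‖ ≤ ‖f‖ := by
      rw [ContinuousMap.norm_le _ (norm_nonneg f)]
      intro ξ
      have h2 : f ξ ≤ ‖f‖ := (le_abs_self _).trans (f.norm_coe_le_norm ξ)
      have h3 : 0 ≤ f ξ := hf ξ
      simp only [ContinuousMap.sub_apply, ContinuousMap.smul_apply, ContinuousMap.one_apply,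
        smul_eq_mul, mul_one, Real.norm_eq_abs]
      rw [abs_of_nonneg (by linarith)]
      linarith
    have h4 := (hlip t (‖f‖ • (1 : C(Config V, ℝ))) f).trans h1
    rw [hUsmul, hUone] at h4
    have h5 := (le_abs_self _).trans
      ((ContinuousMap.norm_coe_le_norm (‖f‖ • (1 : C(Config V, ℝ)) - U t f) η).trans h4)
    simp only [ContinuousMap.sub_apply, ContinuousMap.smul_apply, ContinuousMap.one_apply,
      smul_eq_mul, mul_one] at h5
    change 0 ≤ U t f η
    linarith
  have hmeas : ∀ (t : ℝ≥0) (η : Config V), ∃ μ : Measure (Config V), IsProbabilityMeasure μ ∧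
      ∀ f : C(Config V, ℝ), ∫ ξ, f ξ ∂μ = U t f η := fun t η =>
    exists_measure
      { toFun := fun f => U t f η
        map_add' := fun f g => by rw [hUadd]; rfl
        map_smul' := fun c f => by rw [hUsmul]; rfl }
      (fun f hf => hUpos t f hf η) (by
        change U t 1 η = 1
        rw [hUone]; rfl)
  choose μ hprob hμ using hmeas
  have hfeller : ∀ (t : ℝ≥0) (f : C(Config V, ℝ)), Continuous fun η => ∫ ξ, f ξ ∂(μ t η) := by
    intro t f
    simp_rw [hμ]
    exact (U t f).continuous
  let P : ℝ≥0 → Kernel (Config V) (Config V) := fun t =>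
    { toFun := μ t
      measurable' := measurable_of_feller (μ t) (hfeller t) }
  have hP : ∀ (t : ℝ≥0) (η : Config V) (f : C(Config V, ℝ)), ∫ ξ, f ξ ∂(P t η) = U t f η :=
    fun t η f => hμ t η f
  have hmarkov : ∀ t, IsMarkovKernel (P t) := fun t => ⟨fun η => hprob t η⟩
  refine ⟨P, hmarkov, ⟨?_, ?_, hfeller, ?_⟩, ?_⟩
  · ext1 η
    refine measure_ext_of_continuousMap fun f => ?_
    rw [hP, hU0, Kernel.id_apply, integral_dirac]
  · intro s t
    ext1 η
    refine measure_ext_of_continuousMap fun f => ?_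
    have hi : Integrable f ((P t ∘ₖ P s) η) :=
      Integrable.of_bound f.continuous.aestronglyMeasurable ‖f‖
        (Eventually.of_forall fun ξ => f.norm_coe_le_norm ξ)
    rw [Kernel.integral_comp hi]
    simp_rw [hP]
    rw [hadd]
  · intro f
    have h := ContinuousMap.tendsto_iff_tendstoUniformly.1 (hcont0 f)
    simp_rw [hP]
    exact h
  · rintro f ⟨A, hA⟩
    obtain ⟨c, hc⟩ := hgen f ⟨A, hA⟩ _ (eventually_volOp_eq G σ A f hA)
    rw [Metric.tendstoUniformly_iff]
    intro ε hε
    have hlim : Tendsto (fun t : ℝ≥0 => c * (t : ℝ)) (𝓝[>] 0) (𝓝 0) := by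
      have : Continuous fun t : ℝ≥0 => c * (t : ℝ) := by fun_prop
      have h := this.tendsto 0
      simp only [NNReal.coe_zero, mul_zero] at h
      exact h.mono_left nhdsWithin_le_nhds
    filter_upwards [hlim.eventually_lt_const hε, self_mem_nhdsWithin,
      nhdsWithin_le_nhds (Iic_mem_nhds (zero_lt_one (α := ℝ≥0)))] with t h1 h2 h3 η
    have ht : (0 : ℝ) < t := by exact_mod_cast h2
    rw [← volOp_apply_eq_pregenerator G σ A f hA, hP, dist_comm, Real.dist_eq]
    have h4 := (ContinuousMap.norm_coe_le_norm (U t f - f - (t : ℝ) • volOp G σ A f) η).trans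
      (hc t h3)
    simp only [ContinuousMap.sub_apply, ContinuousMap.smul_apply, smul_eq_mul,
      Real.norm_eq_abs] at h4
    have h5 : (U t f η - f η) / t - volOp G σ A f η =
        (U t f η - f η - t * volOp G σ A f η) / t := by field_simp
    rw [h5, abs_div, abs_of_pos ht, div_lt_iff₀ ht]
    nlinarith

end Kernels

end SignedVoter

end

noncomputable section

namespace SignedVoter

open scoped ENNReal

/-! ### Contractions for the supremum norm and their exponentials -/

section Poisson

theorem hasSum_poisson (t : ℝ) : HasSum (fun k : ℕ => t ^ k / k.factorial) (Real.exp t) := by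
  rw [Real.exp_eq_exp_ℝ]
  exact NormedSpace.expSeries_div_hasSum_exp t

theorem succ_mul_poisson (t : ℝ) (k : ℕ) :
    ((k : ℝ) + 1) * (t ^ (k + 1) / (k + 1).factorial) = t * (t ^ k / k.factorial) := by
  rw [Nat.factorial_succ]
  push_cast
  have : (k.factorial : ℝ) ≠ 0 := by positivity
  have h2 : (k : ℝ) + 1 ≠ 0 := by positivity
  field_simp
  ring

theorem hasSum_mul_poisson (t : ℝ) :
    HasSum (fun k : ℕ => (k : ℝ) * (t ^ k / k.factorial)) (t * Real.exp t) := by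
  rw [← hasSum_nat_add_iff' 1]
  simp only [Finset.range_one, Finset.sum_singleton, Nat.cast_zero, zero_mul, sub_zero,
    Nat.cast_add, Nat.cast_one, succ_mul_poisson]
  exact (hasSum_poisson t).mul_left t

theorem hasSum_sq_mul_poisson (t : ℝ) :
    HasSum (fun k : ℕ => (k : ℝ) ^ 2 * (t ^ k / k.factorial))
      (t * (t * Real.exp t) + t * Real.exp t) := by
  rw [← hasSum_nat_add_iff' 1]
  simp only [Finset.range_one, Finset.sum_singleton, Nat.cast_zero, ne_eq, OfNat.ofNat_ne_zero,
    not_false_eq_true, zero_pow, zero_mul, sub_zero, Nat.cast_add, Nat.cast_one]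
  refine (((hasSum_mul_poisson t).mul_left t).add ((hasSum_poisson t).mul_left t)).congr_fun ?_
  intro k
  rw [pow_two, mul_assoc, succ_mul_poisson]
  ring

theorem hasSum_variance_poisson {t : ℝ} (ht : 0 < t) :
    HasSum (fun k : ℕ => ((k : ℝ) / t - 1) ^ 2 * (t ^ k / k.factorial)) (Real.exp t / t) := by
  have h := (((hasSum_sq_mul_poisson t).mul_left (1 / t ^ 2)).sub
    ((hasSum_mul_poisson t).mul_left (2 / t))).add (hasSum_poisson t)
  have h2 : 1 / t ^ 2 * (t * (t * Real.exp t) + t * Real.exp t) - 2 / t * (t * Real.exp t) +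
      Real.exp t = Real.exp t / t := by field_simp; ring
  rw [h2] at h
  refine h.congr_fun fun k => ?_
  field_simp
  ring

theorem norm_pow_apply_le {B : Type*} [NormedAddCommGroup B] [NormedSpace ℝ B]
    (K : B →L[ℝ] B) (hK : ‖K‖ ≤ 1) (k : ℕ) (f : B) :
    ‖(K ^ k) f‖ ≤ ‖f‖ := by
  induction k with
  | zero => simp
  | succ k ih =>
    rw [pow_succ', mul_apply_eq_comp]
    exact ((K.le_of_opNorm_le hK _).trans (one_mul _).le).trans ih

variable {B : Type*} [NormedAddCommGroup B] [NormedSpace ℝ B] [CompleteSpace B]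

theorem expOp_sub_one (K : B →L[ℝ] B) (t : ℝ) :
    expOp (K - 1) t = Real.exp (-t) • expOp K t := by
  have h1 : t • (K - 1) = t • K + (-t) • 1 := by
    rw [smul_sub, neg_smul, sub_eq_add_neg]
  have h2 : NormedSpace.exp ((-t) • (1 : B →L[ℝ] B)) = Real.exp (-t) • 1 := by
    have := NormedSpace.algebraMap_exp_comm (𝕂 := ℝ) (𝔸 := B →L[ℝ] B) (-t)
    rw [Algebra.algebraMap_eq_smul_one, Algebra.algebraMap_eq_smul_one] at this
    rw [← this, Real.exp_eq_exp_ℝ]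
  have hc : Commute (t • K) ((-t) • (1 : B →L[ℝ] B)) := (Commute.one_right _).smul_right _
  let _ : NormedAlgebra ℚ (B →L[ℝ] B) := NormedAlgebra.restrictScalars ℚ ℝ _
  rw [expOp, expOp, h1, NormedSpace.exp_add_of_commute hc, h2, mul_smul_comm, mul_one]

/-- Along the semigroup generated by `K - 1`, where `K` is a contraction, the generator tends to
zero. -/
theorem norm_sub_one_expOp_le (K : B →L[ℝ] B) (hK : ‖K‖ ≤ 1) {t : ℝ} (ht : 0 < t) (f : B) :
    ‖(K - 1) (expOp (K - 1) t f)‖ ≤ 1 / √t * ‖f‖ := by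
  have hs := hasSum_exp_apply K t f
  have hs1 : HasSum (fun k : ℕ => (((k : ℝ) / t) * (t ^ k / k.factorial)) • (K ^ k) f)
      (K (expOp K t f)) := by
    rw [← hasSum_nat_add_iff' 1]
    simp only [Finset.range_one, Finset.sum_singleton, Nat.cast_zero, zero_div, zero_mul, zero_smul,
      sub_zero, Nat.cast_add, Nat.cast_one]
    refine (hs.mapL K).congr_fun fun k => ?_
    rw [div_mul_eq_mul_div, succ_mul_poisson, mul_div_cancel_left₀ _ ht.ne', map_smul, pow_succ',
      mul_apply_eq_comp]
  have hs2 := hs1.sub hs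
  have hb : HasSum (fun k : ℕ => ((√t / 2) * (((k : ℝ) / t - 1) ^ 2 * (t ^ k / k.factorial)) +
      (1 / (2 * √t)) * (t ^ k / k.factorial)) * ‖f‖)
      ((√t / 2 * (Real.exp t / t) + 1 / (2 * √t) * Real.exp t) * ‖f‖) :=
    (((hasSum_variance_poisson ht).mul_left _).add ((hasSum_poisson t).mul_left _)).mul_right _
  have hsq : 0 < √t := Real.sqrt_pos.2 ht
  have hsqt : √t * √t = t := Real.mul_self_sqrt ht.le
  have hval : (√t / 2 * (Real.exp t / t) + 1 / (2 * √t) * Real.exp t) = Real.exp t * (1 / √t) := by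
    rw [← hsqt]
    simp only [hsqt]
    rw [show √t / 2 * (Real.exp t / t) = √t / 2 * (Real.exp t / (√t * √t)) by rw [hsqt]]
    field_simp
    ring
  rw [hval] at hb
  have hn : ‖K (expOp K t f) - expOp K t f‖ ≤ Real.exp t * (1 / √t) * ‖f‖ := by
    rw [← hs2.tsum_eq]
    refine tsum_of_norm_bounded hb fun k => ?_
    have ha : 0 ≤ t ^ k / (k.factorial : ℝ) := by positivity
    rw [← sub_smul, norm_smul, Real.norm_eq_abs, ← sub_one_mul, abs_mul, abs_of_nonneg ha]
    have h1 : |(k : ℝ) / t - 1| ≤ √t / 2 * ((k : ℝ) / t - 1) ^ 2 + 1 / (2 * √t) := by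
      have h3 : 0 ≤ (√t * |(k : ℝ) / t - 1| - 1) ^ 2 / (2 * √t) := by positivity
      have h4 : (√t * |(k : ℝ) / t - 1| - 1) ^ 2 / (2 * √t) =
          √t / 2 * ((k : ℝ) / t - 1) ^ 2 + 1 / (2 * √t) - |(k : ℝ) / t - 1| := by
        rw [← sq_abs ((k : ℝ) / t - 1)]
        field_simp
        ring
      linarith
    calc |(k : ℝ) / t - 1| * (t ^ k / k.factorial) * ‖(K ^ k) f‖
        ≤ (√t / 2 * ((k : ℝ) / t - 1) ^ 2 + 1 / (2 * √t)) * (t ^ k / k.factorial) * ‖f‖ := by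
          gcongr
          exact norm_pow_apply_le K hK k f
      _ = _ := by ring
  rw [expOp_sub_one, sub_apply, one_apply_eq_self, smul_apply, map_smul, ← smul_sub, norm_smul,
    Real.norm_of_nonneg (Real.exp_nonneg _)]
  calc Real.exp (-t) * ‖K (expOp K t f) - expOp K t f‖
      ≤ Real.exp (-t) * (Real.exp t * (1 / √t) * ‖f‖) := by gcongr
    _ = (Real.exp (-t) * Real.exp t) * (1 / √t * ‖f‖) := by ring
    _ = 1 / √t * ‖f‖ := by rw [← Real.exp_add]; simp

/-- `exp (t (K - 1)) f` is an average of the `K ^ k f`. -/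
theorem abs_sub_expOp_apply_le (l : B →L[ℝ] ℝ) (K : B →L[ℝ] B) {t M : ℝ} (ht : 0 ≤ t) (f : B)
    (h : ∀ k, |l f - l ((K ^ k) f)| ≤ M) : |l f - l (expOp (K - 1) t f)| ≤ M := by
  have hs := (hasSum_exp_apply K t f).mapL l
  have hc := (hasSum_poisson t).mul_right (l f)
  have hd := hc.sub hs
  have hn : |Real.exp t * l f - l (expOp K t f)| ≤ Real.exp t * M := by
    rw [← hd.tsum_eq, ← Real.norm_eq_abs]
    refine tsum_of_norm_bounded ((hasSum_poisson t).mul_right M) fun k => ?_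
    have ha : 0 ≤ t ^ k / (k.factorial : ℝ) := by positivity
    rw [map_smul, smul_eq_mul, ← mul_sub, Real.norm_eq_abs, abs_mul, abs_of_nonneg ha]
    gcongr
    exact h k
  have he : Real.exp (-t) * Real.exp t = 1 := by rw [← Real.exp_add]; simp
  rw [expOp_sub_one, smul_apply, map_smul, smul_eq_mul]
  have h2 : l f - Real.exp (-t) * l (expOp K t f) =
      Real.exp (-t) * (Real.exp t * l f - l (expOp K t f)) := by
    rw [mul_sub, ← mul_assoc, he, one_mul]
  rw [h2, abs_mul, abs_of_pos (Real.exp_pos _)]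
  calc Real.exp (-t) * |Real.exp t * l f - l (expOp K t f)|
      ≤ Real.exp (-t) * (Real.exp t * M) := by gcongr
    _ = M := by rw [← mul_assoc, he, one_mul]

end Poisson

section SupContraction

variable {X : Type*}

/-- A linear operator on real functions that does not increase bounds of the absolute value. -/
def IsSupContraction (T : (X → ℝ) →ₗ[ℝ] (X → ℝ)) : Prop :=
  ∀ (f : X → ℝ) (C : ℝ), (∀ x, |f x| ≤ C) → ∀ x, |T f x| ≤ C

theorem abs_apply_le_norm (f : lp (fun _ : X => ℝ) ∞) (x : X) : |f x| ≤ ‖f‖ :=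
  lp.norm_apply_le_norm ENNReal.top_ne_zero f x

/-- A bounded function, as an element of `ℓ^∞`. -/
def toLp (f : X → ℝ) (C : ℝ) (hf : ∀ x, |f x| ≤ C) : lp (fun _ : X => ℝ) ∞ :=
  ⟨f, memℓp_infty ⟨C, by rintro _ ⟨x, rfl⟩; exact hf x⟩⟩

@[simp] theorem toLp_apply (f : X → ℝ) (C : ℝ) (hf : ∀ x, |f x| ≤ C) (x : X) :
    toLp f C hf x = f x := rfl

/-- The evaluation at a point, as a functional on `ℓ^∞`. -/
def evalLp (x : X) : lp (fun _ : X => ℝ) ∞ →L[ℝ] ℝ :=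
  LinearMap.mkContinuous
    { toFun := fun f => f x
      map_add' := fun _ _ => rfl
      map_smul' := fun _ _ => rfl } 1 fun f => by
    rw [one_mul]
    exact abs_apply_le_norm f x

@[simp] theorem evalLp_apply (x : X) (f : lp (fun _ : X => ℝ) ∞) : evalLp x f = f x := rfl

/-- A contraction for the supremum norm, as an operator on `ℓ^∞`. -/
def IsSupContraction.op {T : (X → ℝ) →ₗ[ℝ] (X → ℝ)} (hT : IsSupContraction T) :
    lp (fun _ : X => ℝ) ∞ →L[ℝ] lp (fun _ : X => ℝ) ∞ :=
  LinearMap.mkContinuous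
    { toFun := fun f => toLp (T f) ‖f‖ (hT f ‖f‖ (abs_apply_le_norm f))
      map_add' := fun f g => by
        ext x
        change T (⇑f + ⇑g) x = T f x + T g x
        rw [map_add]
        rfl
      map_smul' := fun c f => by
        ext x
        simp } 1 fun f => by
    rw [one_mul]
    exact lp.norm_le_of_forall_le (norm_nonneg f) (hT f ‖f‖ (abs_apply_le_norm f))

theorem IsSupContraction.op_apply {T : (X → ℝ) →ₗ[ℝ] (X → ℝ)} (hT : IsSupContraction T)
    (f : lp (fun _ : X => ℝ) ∞) : ⇑(hT.op f) = T f := rfl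

theorem IsSupContraction.norm_op_le {T : (X → ℝ) →ₗ[ℝ] (X → ℝ)} (hT : IsSupContraction T) :
    ‖hT.op‖ ≤ 1 :=
  LinearMap.mkContinuous_norm_le _ zero_le_one _

theorem IsSupContraction.op_pow_apply {T : (X → ℝ) →ₗ[ℝ] (X → ℝ)} (hT : IsSupContraction T)
    (k : ℕ) (f : lp (fun _ : X => ℝ) ∞) : ⇑((hT.op ^ k) f) = (T ^ k) f := by
  induction k with
  | zero => rfl
  | succ k ih =>
    rw [pow_succ', mul_apply_eq_comp, hT.op_apply, ih, pow_succ']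
    rfl

/-- If `f` is bounded by `C`, its exponential averages tend to zero and `f` is nearly fixed by `T`,
with an error that is controlled by the excess of the subharmonic function `|f|`, then `f` is bounded
by `C / 2`. -/
theorem abs_le_half_of_tendsto {T : (X → ℝ) →ₗ[ℝ] (X → ℝ)} (hT : IsSupContraction T)
    {N : (X → ℝ) →ₗ[ℝ] (X → ℝ)} (hN : IsSupContraction N)
    (hTN : ∀ (f g : X → ℝ), (∀ x, |f x| ≤ g x) → ∀ x, |T f x| ≤ N g x)
    (f : X → ℝ) (C : ℝ) (hf : ∀ x, |f x| ≤ C)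
    (hfT : ∀ x, |f x - T f x| ≤ N (fun y => |f y|) x - |f x|)
    (hlim : ∀ x, Tendsto (fun t : ℝ => expOp (hT.op - 1) t (toLp f C hf) x) atTop (𝓝 0)) (x : X) :
    |f x| ≤ C / 2 := by
  have hstep : ∀ (k : ℕ) x, |(T ^ k) f x - (T ^ (k + 1)) f x| ≤
      (N ^ (k + 1)) (fun y => |f y|) x - (N ^ k) (fun y => |f y|) x := by
    intro k
    induction k with
    | zero => simpa using hfT
    | succ k ih =>
      intro x
      have h := hTN ((T ^ k) f - (T ^ (k + 1)) f) ((N ^ (k + 1)) (fun y => |f y|) -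
        (N ^ k) (fun y => |f y|)) ih x
      rw [map_sub, map_sub] at h
      simp only [pow_succ' _ k, pow_succ' _ (k + 1), Module.End.mul_apply] at h ⊢
      exact h
  have hsum : ∀ (k : ℕ) x, |f x - (T ^ k) f x| ≤ (N ^ k) (fun y => |f y|) x - |f x| := by
    intro k x
    induction k with
    | zero => simp
    | succ k ih =>
      have h1 := hstep k x
      have h2 := abs_sub_le (f x) ((T ^ k) f x) ((T ^ (k + 1)) f x)
      linarith
  have hNk : ∀ (k : ℕ) x, |(N ^ k) (fun y => |f y|) x| ≤ C := by
    intro k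
    induction k with
    | zero => simpa using hf
    | succ k ih =>
      rw [pow_succ']
      exact hN _ C ih
  have hexp : ∀ t : ℝ, 0 ≤ t → |f x - expOp (hT.op - 1) t (toLp f C hf) x| ≤ C - |f x| := by
    intro t ht
    refine abs_sub_expOp_apply_le (evalLp x) hT.op ht (toLp f C hf) fun k => ?_
    simp only [evalLp_apply, hT.op_pow_apply]
    have h1 := hsum k x
    have h2 := (le_abs_self _).trans (hNk k x)
    exact h1.trans (by linarith)
  have hl := le_of_tendsto (((hlim x).const_sub (f x)).abs)
    ((eventually_ge_atTop (0 : ℝ)).mono fun t ht => hexp t ht)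
  rw [sub_zero] at hl
  linarith

end SupContraction

/-! ### From unsatisfied cycles of the continuous time path to those of the visited sites -/

section Cycles

variable {V : Type*} {G : SimpleGraph V} {σ : Sym2 V → ℤˣ}

/-- The sequence of sites `s` traverses arbitrarily late unsatisfied cycles. -/
def HasLateUnsatisfiedCycles (σ : Sym2 V → ℤˣ) (s : ℕ → V) : Prop :=
  ∀ N, ∃ m ≥ N, ∃ n, s m = s (m + n) ∧
    ∏ j ∈ Finset.range n, σ s(s (m + j), s (m + (j + 1))) = -1

theorem apply_jump_time {γ : ℝ≥0 → V} {b : ℝ≥0} {n : ℕ} {τ : ℕ → ℝ≥0} {v : ℕ → V}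
    (hτ : ∀ i < n, τ i < τ (i + 1)) (hb : τ n ≤ b)
    (hv : ∀ i < n, ∀ u ∈ Set.Ico (τ i) (τ (i + 1)), γ u = v i)
    (hvn : ∀ u ∈ Set.Icc (τ n) b, γ u = v n) {i : ℕ} (hi : i ≤ n) : γ (τ i) = v i := by
  rcases hi.lt_or_eq with h | rfl
  · exact hv i h _ ⟨le_rfl, hτ i h⟩
  · exact hvn _ ⟨le_rfl, hb⟩

theorem not_hasSignOn_of_const {γ : ℝ≥0 → V} {a b : ℝ≥0} {x : V} (hγ : ∀ u, a ≤ u → γ u = x) :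
    ¬ HasSignOn G σ γ a b (-1) := by
  rintro ⟨n, τ, v, h0, hτ, hb, hv, hvn, hadj, hprod⟩
  rcases n.eq_zero_or_pos with rfl | hn
  · simp at hprod
  · have h1 : v 0 = x := by
      rw [← apply_jump_time hτ hb hv hvn hn.le, h0]
      exact hγ a le_rfl
    have h2 : v (0 + 1) = x := by
      rw [← apply_jump_time hτ hb hv hvn (i := 0 + 1) hn]
      exact hγ _ (h0 ▸ (hτ 0 hn).le)
    exact (hadj 0 hn).ne (h1.trans h2.symm)

theorem walkPath_eq {ω : (ℕ → V) × (ℕ → ℝ)} (hpos : ∀ n, 0 < ω.2 n) {t : ℝ≥0} {k : ℕ}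
    (h1 : ∑ i ∈ Finset.range k, ω.2 i ≤ t) (h2 : t < ∑ i ∈ Finset.range (k + 1), ω.2 i) :
    walkPath ω t = ω.1 k := by
  have hmono : Monotone fun n => ∑ i ∈ Finset.range n, ω.2 i :=
    monotone_nat_of_le_succ fun n => by
      rw [Finset.sum_range_succ]
      linarith [hpos n]
  have hset : {n : ℕ | ∑ i ∈ Finset.range (n + 1), ω.2 i ≤ t} = (Finset.range k : Set ℕ) := by
    ext n
    simp only [Set.mem_ofPred_eq, Finset.coe_range, Set.mem_Iio]
    constructor
    · intro h
      by_contra! hkn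
      have := hmono (Nat.succ_le_succ hkn)
      simp only [Nat.succ_eq_add_one] at this
      linarith
    · intro h
      exact (hmono (Nat.succ_le_of_lt h)).trans h1
  rw [walkPath, hset, Set.ncard_coe_finset, Finset.card_range]

theorem TraversesInfinitelyManyUnsatisfiedCycles.hasLateUnsatisfiedCycles
    {ω : (ℕ → V) × (ℕ → ℝ)} (hpos : ∀ n, 0 < ω.2 n) (hadj : ∀ n, G.Adj (ω.1 n) (ω.1 (n + 1)))
    (h : TraversesInfinitelyManyUnsatisfiedCycles G σ (walkPath ω)) :
    HasLateUnsatisfiedCycles σ ω.1 := by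
  obtain ⟨a, b, ha, -, hab⟩ := h
  have hmono : StrictMono fun n => ∑ i ∈ Finset.range n, ω.2 i :=
    strictMono_nat_of_lt_succ fun n => by
      rw [Finset.sum_range_succ]
      linarith [hpos n]
  by_cases hbdd : ∀ t : ℝ≥0, ∃ k : ℕ, t < ∑ i ∈ Finset.range k, ω.2 i
  swap
  · push Not at hbdd
    obtain ⟨t, ht⟩ := hbdd
    obtain ⟨i, hi⟩ := (ha.eventually_ge_atTop t).exists
    refine absurd (hab i).2 (not_hasSignOn_of_const (x := ω.1 0) fun u hu => ?_)
    have hset : {n : ℕ | ∑ i ∈ Finset.range (n + 1), ω.2 i ≤ u} = Set.univ :=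
      Set.eq_univ_of_forall fun n => (ht _).trans (by exact_mod_cast hi.trans hu)
    rw [walkPath, hset, Set.infinite_univ.ncard]
  have hloc : ∀ t : ℝ≥0, ∃ k : ℕ, ∑ i ∈ Finset.range k, ω.2 i ≤ t ∧
      t < ∑ i ∈ Finset.range (k + 1), ω.2 i := by
    intro t
    classical
    have hk := Nat.find_spec (hbdd t)
    have hmin := fun m => Nat.find_min (hbdd t) (m := m)
    rcases hf : Nat.find (hbdd t) with _ | k
    · rw [hf] at hk
      simp only [Finset.range_zero, Finset.sum_empty] at hk
      exact absurd hk (not_lt.2 t.coe_nonneg)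
    · rw [hf] at hk hmin
      exact ⟨k, not_lt.1 (hmin k (Nat.lt_succ_self k)), hk⟩
  intro N
  obtain ⟨i, hi⟩ := (ha.eventually_ge_atTop
    (⟨∑ i ∈ Finset.range N, ω.2 i, Finset.sum_nonneg fun i _ => (hpos i).le⟩ : ℝ≥0)).exists
  obtain ⟨hcl, n, τ, v, h0, hτ, hb, hv, hvn, hvadj, hprod⟩ := hab i
  obtain ⟨k, hk1, hk2⟩ := hloc (a i)
  have hNk : N ≤ k := by
    have h1 : ∑ i ∈ Finset.range N, ω.2 i ≤ a i := by exact_mod_cast hi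
    exact Nat.lt_succ_iff.1 (hmono.lt_iff_lt.1 (h1.trans_lt hk2))
  have hval := fun i (hi : i ≤ n) => apply_jump_time hτ hb hv hvn hi
  have key : ∀ i ≤ n, (∑ j ∈ Finset.range (k + i), ω.2 j ≤ τ i ∧
      τ i < ∑ j ∈ Finset.range (k + i + 1), ω.2 j) ∧ v i = ω.1 (k + i) := by
    intro i
    induction i with
    | zero =>
      intro _
      rw [h0]
      refine ⟨⟨hk1, hk2⟩, ?_⟩
      rw [← hval 0 (Nat.zero_le n), h0]
      exact walkPath_eq hpos hk1 hk2
    | succ i ih =>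
      intro hi
      obtain ⟨⟨h1, h2⟩, h3⟩ := ih (Nat.le_of_succ_le hi)
      have h4 : ∑ j ∈ Finset.range (k + i + 1), ω.2 j ≤ τ (i + 1) := by
        by_contra! h5
        have h6 := walkPath_eq hpos (h1.trans (by exact_mod_cast (hτ i hi).le)) h5
        rw [hval (i + 1) hi, ← h3] at h6
        exact (hvadj i hi).ne h6.symm
      have h7 : ∑ j ∈ Finset.range (k + i + 1), ω.2 j <
          ∑ j ∈ Finset.range (k + i + 1 + 1), ω.2 j := hmono (Nat.lt_succ_self _)
      have h8 : (τ (i + 1) : ℝ) ≤ ∑ j ∈ Finset.range (k + i + 1), ω.2 j := by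
        by_contra! h9
        let u : ℝ≥0 := ⟨∑ j ∈ Finset.range (k + i + 1), ω.2 j,
          Finset.sum_nonneg fun i _ => (hpos i).le⟩
        have hu1 : walkPath ω u = v i := hv i hi u
          ⟨by exact_mod_cast h2.le, by exact_mod_cast h9⟩
        have hu2 : walkPath ω u = ω.1 (k + i + 1) := walkPath_eq hpos le_rfl h7
        rw [hu1, h3] at hu2
        exact (hadj (k + i)).ne hu2
      have h9 := h8.trans_lt h7
      exact ⟨⟨h4, h9⟩, by rw [← hval (i + 1) hi]; exact walkPath_eq hpos h4 h9⟩
  refine ⟨k, hNk, n, ?_, ?_⟩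
  · have h1 : walkPath ω (a i) = v 0 := by rw [← h0]; exact hval 0 (Nat.zero_le n)
    have h2 : walkPath ω (b i) = v n := hvn _ ⟨hb, le_rfl⟩
    rw [← (key n le_rfl).2, ← h2, ← hcl, h1, (key 0 (Nat.zero_le n)).2, add_zero]
  · rw [← hprod]
    refine Finset.prod_congr rfl fun j hj => ?_
    have hj' := Finset.mem_range.1 hj
    rw [(key j hj'.le).2, (key (j + 1) hj').2]

end Cycles

/-! ### Bounded functions that are harmonic for the signed walk -/

section Chain

variable {V : Type*} (G : SimpleGraph V) [G.LocallyFinite] (σ : Sym2 V → ℤˣ)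

/-- The signed average of `f` over the neighbours of `x`. -/
def signedAverage (f : V → ℝ) (x : V) : ℝ :=
  1 / (G.degree x : ℝ) * ∑ y ∈ G.neighborFinset x, (σ s(x, y) : ℝ) * f y

/-- The sign of the first `n` steps of the sequence of sites `ω`. -/
def pathSign (σ : Sym2 V → ℤˣ) (n : ℕ) (ω : ℕ → V) : ℤˣ :=
  ∏ j ∈ Finset.range n, σ s(ω j, ω (j + 1))

theorem pathSign_succ (n : ℕ) (ω : ℕ → V) :
    pathSign σ (n + 1) ω = pathSign σ n ω * σ s(ω n, ω (n + 1)) :=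
  Finset.prod_range_succ _ _

theorem pathSign_congr {n : ℕ} {ω ω' : ℕ → V} (h : ∀ k ≤ n, ω k = ω' k) :
    pathSign σ n ω = pathSign σ n ω' :=
  Finset.prod_congr rfl fun j hj => by
    have hj := Finset.mem_range.1 hj
    rw [h j hj.le, h (j + 1) hj]

theorem abs_unit_cast (u : ℤˣ) : |((u : ℤ) : ℝ)| = 1 := by
  rcases Int.units_eq_one_or u with rfl | rfl <;> simp

/-- The infinite sequence that continues `h` as a constant. -/
def extendConst {n : ℕ} (h : Finset.Iic n → V) (k : ℕ) : V :=
  h ⟨min k n, Finset.mem_Iic.2 (min_le_right k n)⟩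

theorem extendConst_frestrictLe {n : ℕ} (ω : ℕ → V) {k : ℕ} (hk : k ≤ n) :
    extendConst (Preorder.frestrictLe (π := fun _ : ℕ => V) n ω) k = ω k := by
  simp [extendConst, min_eq_left hk]

variable [MeasurableSpace V] [DiscreteMeasurableSpace V]

theorem integral_stepKernel {x : V} (hx : 0 < G.degree x) (f : V → ℝ) :
    ∫ y, f y ∂(stepKernel G x) = 1 / (G.degree x : ℝ) * ∑ y ∈ G.neighborFinset x, f y := by
  classical
  have hne : (G.neighborFinset x).Nonempty := Finset.card_pos.1 hx
  have h1 : stepKernel G x = (PMF.uniformOfFinset (G.neighborFinset x) hne).toMeasure :=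
    dif_pos hne
  rw [h1, PMF.integral_eq_tsum _ _ ?_]
  · rw [tsum_eq_sum (s := G.neighborFinset x), Finset.mul_sum]
    · refine Finset.sum_congr rfl fun y hy => ?_
      rw [PMF.uniformOfFinset_apply_of_mem hne hy]
      simp
    · intro y hy
      rw [PMF.uniformOfFinset_apply_of_notMem hne hy]
      simp
  · have h2 : Integrable ((G.neighborFinset x : Set V).indicator f)
        (PMF.uniformOfFinset (G.neighborFinset x) hne).toMeasure := by
      have hfin : (Set.range ((G.neighborFinset x : Set V).indicator f)).Finite := by
        refine Set.Finite.subset (((G.neighborFinset x).finite_toSet.image f).insert 0) ?_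
        rintro _ ⟨y, rfl⟩
        by_cases hy : y ∈ (G.neighborFinset x : Set V)
        · rw [Set.indicator_of_mem hy]
          exact Or.inr ⟨y, hy, rfl⟩
        · rw [Set.indicator_of_notMem hy]
          exact Or.inl rfl
      obtain ⟨C, hC⟩ := (hfin.isCompact.isBounded).exists_norm_le
      exact Integrable.of_bound (Measurable.of_discrete).aestronglyMeasurable C
        (Eventually.of_forall fun y => hC _ ⟨y, rfl⟩)
    refine h2.congr ?_
    have h3 : ∀ᵐ y ∂(PMF.uniformOfFinset (G.neighborFinset x) hne).toMeasure,
        y ∈ (G.neighborFinset x : Set V) := by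
      rw [ae_iff, PMF.toMeasure_apply_eq_zero_iff _ MeasurableSet.of_discrete]
      rw [PMF.support_uniformOfFinset]
      exact Set.disjoint_left.2 fun y hy hy' => hy' hy
    filter_upwards [h3] with y hy
    exact Set.indicator_of_mem hy f

theorem ae_stepKernel (x : V) :
    ∀ᵐ y ∂(stepKernel G x), G.Adj x y ∨ (G.degree x = 0 ∧ y = x) := by
  classical
  by_cases hne : (G.neighborFinset x).Nonempty
  · have h1 : stepKernel G x = (PMF.uniformOfFinset (G.neighborFinset x) hne).toMeasure :=
      dif_pos hne
    rw [h1, ae_iff, PMF.toMeasure_apply_eq_zero_iff _ MeasurableSet.of_discrete,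
      PMF.support_uniformOfFinset]
    refine Set.disjoint_left.2 fun y hy hy' => hy' (Or.inl ?_)
    simpa using hy
  · have h1 : stepKernel G x = Measure.dirac x := dif_neg hne
    rw [h1, ae_dirac_iff MeasurableSet.of_discrete]
    exact Or.inr ⟨Finset.card_eq_zero.2 (Finset.not_nonempty_iff_eq_empty.1 hne), rfl⟩

instance (x : V) : IsProbabilityMeasure (chainLaw G x) := by
  unfold chainLaw
  infer_instance

/-- The kernel that governs the `n`-th step of the simple random walk, given the sites visited. -/
def historyKernel (n : ℕ) : Kernel (Finset.Iic n → V) V :=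
  (stepKernel G).comap (fun h : (Finset.Iic n → V) => h ⟨n, Finset.mem_Iic.2 le_rfl⟩)
    (measurable_pi_apply _)

instance (n : ℕ) : IsMarkovKernel (historyKernel G n) := by
  unfold historyKernel
  infer_instance

theorem historyKernel_apply (n : ℕ) (h : Finset.Iic n → V) :
    historyKernel G n h = stepKernel G (h ⟨n, Finset.mem_Iic.2 le_rfl⟩) := rfl

theorem map_history_chainLaw (x : V) (n : ℕ) :
    (chainLaw G x).map (Preorder.frestrictLe (π := fun _ : ℕ => V) n) ⊗ₘ historyKernel G n =
      (chainLaw G x).map fun ω => (Preorder.frestrictLe (π := fun _ : ℕ => V) n ω, ω (n + 1)) :=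
  Kernel.map_frestrictLe_trajMeasure_compProd_eq_map_trajMeasure (X := fun _ : ℕ => V)

theorem ae_chainLaw_zero (x : V) : ∀ᵐ ω ∂(chainLaw G x), ω 0 = x := by
  have h1 : (chainLaw G x).map (Preorder.frestrictLe (π := fun _ : ℕ => V) 0) =
      (Measure.dirac x).map (MeasurableEquiv.piUnique fun _ : Finset.Iic 0 => V).symm := by
    rw [chainLaw, Kernel.trajMeasure, Measure.map_comp _ _ (by fun_prop),
      Kernel.traj_map_frestrictLe, Kernel.partialTraj_self, Measure.id_comp]
  have h2 : (chainLaw G x).map (fun ω => ω 0) = Measure.dirac x := by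
    have h3 : (fun ω : ℕ → V => ω 0) = (MeasurableEquiv.piUnique fun _ : Finset.Iic 0 => V) ∘
        (Preorder.frestrictLe (π := fun _ : ℕ => V) 0) := by
      ext ω
      rfl
    rw [h3, ← Measure.map_map (by fun_prop) (by fun_prop), h1, Measure.map_map (by fun_prop)
      (by fun_prop)]
    simp
  have h4 : ∀ᵐ y ∂((chainLaw G x).map (fun ω => ω 0)), y = x := by
    rw [h2, ae_dirac_iff MeasurableSet.of_discrete]
  exact ae_of_ae_map (measurable_pi_apply 0).aemeasurable h4

variable [Countable V]

theorem ae_chainLaw_step (x : V) : ∀ᵐ ω ∂(chainLaw G x), ∀ n,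
    G.Adj (ω n) (ω (n + 1)) ∨ (G.degree (ω n) = 0 ∧ ω (n + 1) = ω n) := by
  rw [ae_all_iff]
  intro n
  have h1 : ∀ᵐ p ∂((chainLaw G x).map (Preorder.frestrictLe (π := fun _ : ℕ => V) n) ⊗ₘ
      historyKernel G n), G.Adj (p.1 ⟨n, Finset.mem_Iic.2 le_rfl⟩) p.2 ∨
        (G.degree (p.1 ⟨n, Finset.mem_Iic.2 le_rfl⟩) = 0 ∧
          p.2 = p.1 ⟨n, Finset.mem_Iic.2 le_rfl⟩) := by
    rw [Measure.ae_compProd_iff MeasurableSet.of_discrete]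
    exact Eventually.of_forall fun h => ae_stepKernel G _
  rw [map_history_chainLaw] at h1
  exact ae_of_ae_map (by fun_prop) h1

/-- The signed martingale of a harmonic function. -/
theorem martingale_pathSign_mul (hdeg : ∀ x, 0 < G.degree x) {u : V → ℝ} {C : ℝ}
    (hC : ∀ x, |u x| ≤ C) (hu : ∀ x, signedAverage G σ u x = u x) (x : V) :
    Martingale (fun n (ω : ℕ → V) => ((pathSign σ n ω : ℤ) : ℝ) * u (ω n))
      (Filtration.piLE (X := fun _ : ℕ => V)) (chainLaw G x) := by
  have hfac : ∀ n, (fun ω : ℕ → V => ((pathSign σ n ω : ℤ) : ℝ) * u (ω n)) =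
      (fun h : Finset.Iic n → V => ((pathSign σ n (extendConst h) : ℤ) : ℝ) *
        u (extendConst h n)) ∘ Preorder.frestrictLe (π := fun _ : ℕ => V) n := by
    intro n
    ext ω
    simp only [Function.comp_apply]
    rw [pathSign_congr σ (fun k hk => extendConst_frestrictLe ω hk),
      extendConst_frestrictLe ω le_rfl]
  have hbound : ∀ n (ω : ℕ → V), |((pathSign σ n ω : ℤ) : ℝ) * u (ω n)| ≤ C := fun n ω => by
    rw [abs_mul, abs_unit_cast, one_mul]
    exact hC _
  have hmeas : ∀ n, Measurable fun ω : ℕ → V => ((pathSign σ n ω : ℤ) : ℝ) * u (ω n) := by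
    intro n
    rw [hfac n]
    exact Measurable.of_discrete.comp (by fun_prop)
  refine martingale_of_setIntegral_eq_succ ?_ ?_ ?_
  · intro n
    refine Measurable.stronglyMeasurable ?_
    beta_reduce
    rw [Filtration.piLE_eq_comap_frestrictLe, hfac n]
    exact Measurable.of_discrete.comp (comap_measurable _)
  · exact fun n => Integrable.of_bound (hmeas n).aestronglyMeasurable C
      (Eventually.of_forall fun ω => hbound n ω)
  · intro n s hs
    rw [Filtration.piLE_eq_comap_frestrictLe] at hs
    obtain ⟨t, ht, rfl⟩ := hs
    have hpre : MeasurableSet (Preorder.frestrictLe (π := fun _ : ℕ => V) n ⁻¹' t) :=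
      ht.preimage (by fun_prop)
    rw [← integral_indicator hpre, ← integral_indicator hpre]
    let F : (Finset.Iic n → V) × V → ℝ := fun p => t.indicator 1 p.1 *
      (((pathSign σ n (extendConst p.1) : ℤ) : ℝ) *
        (((σ s(extendConst p.1 n, p.2) : ℤ) : ℝ) * u p.2))
    have hF : Measurable F := Measurable.of_discrete
    have hFb : ∀ p, ‖F p‖ ≤ C := by
      intro p
      have hC0 : 0 ≤ C := (abs_nonneg _).trans (hC p.2)
      by_cases hp : p.1 ∈ t
      · simp only [F, Set.indicator_of_mem hp, Pi.one_apply, one_mul, Real.norm_eq_abs, abs_mul,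
          abs_unit_cast]
        exact hC _
      · simpa [F, Set.indicator_of_notMem hp] using hC0
    have h1 : ∫ ω, F (Preorder.frestrictLe (π := fun _ : ℕ => V) n ω, ω (n + 1)) ∂(chainLaw G x) =
        ∫ p, F p ∂((chainLaw G x).map (Preorder.frestrictLe (π := fun _ : ℕ => V) n) ⊗ₘ
          historyKernel G n) := by
      rw [map_history_chainLaw, integral_map (by fun_prop) hF.aestronglyMeasurable]
    rw [Measure.integral_compProd (Integrable.of_bound hF.aestronglyMeasurable C
      (Eventually.of_forall hFb))] at h1
    rw [integral_map (by fun_prop) (Measurable.of_discrete).aestronglyMeasurable] at h1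
    have h2 : ∀ ω : ℕ → V, ∫ y, F (Preorder.frestrictLe (π := fun _ : ℕ => V) n ω, y)
        ∂(historyKernel G n (Preorder.frestrictLe (π := fun _ : ℕ => V) n ω)) =
        (Preorder.frestrictLe (π := fun _ : ℕ => V) n ⁻¹' t).indicator
          (fun ω => ((pathSign σ n ω : ℤ) : ℝ) * u (ω n)) ω := by
      intro ω
      simp only [F]
      rw [integral_const_mul, integral_const_mul, historyKernel_apply,
        integral_stepKernel G (hdeg _), extendConst_frestrictLe ω le_rfl,
        pathSign_congr σ (fun k hk => extendConst_frestrictLe ω hk)]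
      have h3 := hu (ω n)
      rw [signedAverage] at h3
      change _ * (_ * (1 / (G.degree (ω n) : ℝ) * ∑ y ∈ G.neighborFinset (ω n), _)) = _
      rw [h3]
      by_cases hω : Preorder.frestrictLe (π := fun _ : ℕ => V) n ω ∈ t
      · rw [Set.indicator_of_mem hω, Set.indicator_of_mem (by exact hω)]
        simp
      · rw [Set.indicator_of_notMem hω, Set.indicator_of_notMem (by exact hω)]
        simp
    simp_rw [h2] at h1
    rw [← h1]
    refine integral_congr_ae (Eventually.of_forall fun ω => ?_)
    simp only [F]
    rw [extendConst_frestrictLe ω le_rfl,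
      pathSign_congr σ (fun k hk => extendConst_frestrictLe ω hk)]
    by_cases hω : Preorder.frestrictLe (π := fun _ : ℕ => V) n ω ∈ t
    · rw [Set.indicator_of_mem hω, Set.indicator_of_mem (by exact hω), pathSign_succ]
      push_cast
      simp
      ring
    · rw [Set.indicator_of_notMem hω, Set.indicator_of_notMem (by exact hω)]
      simp

/-- If the random walk traverses unsatisfied cycles at arbitrarily late times, then there is no
nonzero bounded harmonic function of the signed walk. -/
theorem eq_zero_of_signedAverage_eq (hdeg : ∀ x, 0 < G.degree x)
    (hcyc : ∀ x, ∀ᵐ ω ∂(chainLaw G x), HasLateUnsatisfiedCycles σ ω) {u : V → ℝ} {C : ℝ}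
    (hC : ∀ x, |u x| ≤ C) (hu : ∀ x, signedAverage G σ u x = u x) (x : V) : u x = 0 := by
  have hM := martingale_pathSign_mul G σ hdeg hC hu x
  have hbound : ∀ n (ω : ℕ → V), ‖((pathSign σ n ω : ℤ) : ℝ) * u (ω n)‖ ≤ C := fun n ω => by
    rw [Real.norm_eq_abs, abs_mul, abs_unit_cast, one_mul]
    exact hC _
  have hconv : ∀ᵐ ω ∂(chainLaw G x),
      Tendsto (fun n => ((pathSign σ n ω : ℤ) : ℝ) * u (ω n)) atTop (𝓝 0) := by
    have h1 := hM.submartingale.exists_ae_tendsto_of_bdd (R := C.toNNReal) fun n => by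
      refine (eLpNorm_le_of_ae_bound (Eventually.of_forall fun ω => hbound n ω)).trans ?_
      simp [ENNReal.ofReal]
    filter_upwards [h1, hcyc x] with ω ⟨c, hc⟩ hω
    suffices h : c = 0 by rwa [h] at hc
    choose m hm n hmn hprod using hω
    have hmt : Tendsto m atTop atTop := tendsto_atTop_mono hm tendsto_id
    have hmt' : Tendsto (fun N => m N + n N) atTop atTop :=
      tendsto_atTop_mono (fun N => Nat.le_add_right _ _) hmt
    have h2 := hc.comp hmt
    have h3 := hc.comp hmt'
    have h4 : ∀ N, ((fun n => ((pathSign σ n ω : ℤ) : ℝ) * u (ω n)) ∘ fun N => m N + n N) N =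
        -((fun n => ((pathSign σ n ω : ℤ) : ℝ) * u (ω n)) ∘ m) N := by
      intro N
      simp only [Function.comp_apply]
      have h5 : pathSign σ (m N + n N) ω = -pathSign σ (m N) ω := by
        rw [pathSign, Finset.prod_range_add]
        have h6 := hprod N
        simp only [← add_assoc] at h6
        rw [h6, mul_neg_one]
        rfl
      rw [h5, ← hmn N]
      simp
    have h5 := tendsto_nhds_unique (h3.congr h4) h2.neg
    linarith
  have hint : ∀ n, ∫ ω, ((pathSign σ n ω : ℤ) : ℝ) * u (ω n) ∂(chainLaw G x) = u x := by
    intro n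
    have h1 := hM.setIntegral_eq (Nat.zero_le n) MeasurableSet.univ
    rw [setIntegral_univ, setIntegral_univ] at h1
    rw [← h1]
    have h2 : ∀ᵐ ω ∂(chainLaw G x), ((pathSign σ 0 ω : ℤ) : ℝ) * u (ω 0) = u x := by
      filter_upwards [ae_chainLaw_zero G x] with ω hω
      simp [pathSign, hω]
    rw [integral_congr_ae h2]
    simp
  have hlim := tendsto_integral_of_dominated_convergence (μ := chainLaw G x)
    (F := fun n (ω : ℕ → V) => ((pathSign σ n ω : ℤ) : ℝ) * u (ω n)) (f := fun _ => 0)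
    (fun _ => C) (fun n => (hM.integrable n).aestronglyMeasurable) (integrable_const C)
    (fun n => Eventually.of_forall fun ω => hbound n ω) hconv
  simp only [hint, integral_zero] at hlim
  exact tendsto_nhds_unique tendsto_const_nhds hlim

end Chain

section Hypothesis

variable {V : Type*} [MeasurableSpace V] [DiscreteMeasurableSpace V]
  {G : SimpleGraph V} [G.LocallyFinite] {σ : Sym2 V → ℤˣ}

instance : IsProbabilityMeasure (expMeasure 1) := isProbabilityMeasure_expMeasure one_pos

theorem ae_holdingTimes_pos :
    ∀ᵐ τ ∂(Measure.infinitePi fun _ : ℕ => expMeasure 1), ∀ n, 0 < τ n := by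
  rw [ae_all_iff]
  intro n
  have h1 : ∀ᵐ t ∂(expMeasure 1), 0 < t := by
    rw [expMeasure, gammaMeasure, ae_withDensity_iff (f := gammaPDF 1 1)
      (measurable_gammaPDFReal 1 1).ennreal_ofReal]
    filter_upwards [Measure.ae_ne volume 0] with t ht h
    exact lt_of_not_ge fun h' => h (gammaPDF_of_neg (h'.lt_of_ne ht))
  rw [← Measure.infinitePi_map_eval (fun _ : ℕ => expMeasure 1) n] at h1
  exact ae_of_ae_map (measurable_pi_apply n).aemeasurable h1

theorem ae_exists_holdingTimes
    {x : V} (hG : ∀ᵐ ω ∂(walkLaw G x),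
      TraversesInfinitelyManyUnsatisfiedCycles G σ (walkPath ω)) :
    ∀ᵐ s ∂(chainLaw G x), ∃ τ : ℕ → ℝ, (∀ n, 0 < τ n) ∧
      TraversesInfinitelyManyUnsatisfiedCycles G σ (walkPath (s, τ)) := by
  filter_upwards [Measure.ae_ae_of_ae_prod hG] with s hs
  exact (ae_holdingTimes_pos.and hs).exists

variable [Countable V]

theorem degree_pos_of_traverses {x : V} (hG : ∀ᵐ ω ∂(walkLaw G x),
      TraversesInfinitelyManyUnsatisfiedCycles G σ (walkPath ω)) : 0 < G.degree x := by
  by_contra! h0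
  obtain ⟨s, ⟨τ, -, a, b, -, -, hab⟩, hstep, hs0⟩ :=
    ((ae_exists_holdingTimes hG).and ((ae_chainLaw_step G x).and (ae_chainLaw_zero G x))).exists
  have hconst : ∀ n, s n = x := by
    intro n
    induction n with
    | zero => exact hs0
    | succ n ih =>
      rcases hstep n with h | h
      · rw [ih] at h
        have : 0 < G.degree x := (G.degree_pos_iff_exists_adj x).2 ⟨_, h⟩
        omega
      · rw [h.2, ih]
  exact not_hasSignOn_of_const (x := x) (fun u _ => hconst _) (hab 0).2

theorem ae_hasLateUnsatisfiedCycles (hdeg : ∀ x, 0 < G.degree x) {x : V}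
    (hG : ∀ᵐ ω ∂(walkLaw G x), TraversesInfinitelyManyUnsatisfiedCycles G σ (walkPath ω)) :
    ∀ᵐ s ∂(chainLaw G x), HasLateUnsatisfiedCycles σ s := by
  filter_upwards [ae_exists_holdingTimes hG, ae_chainLaw_step G x] with s ⟨τ, hτ, hs⟩ hstep
  refine TraversesInfinitelyManyUnsatisfiedCycles.hasLateUnsatisfiedCycles (ω := (s, τ)) hτ
    (fun n => ?_) hs
  exact (hstep n).resolve_right fun h => (hdeg _).ne' h.1

end Hypothesis

/-! ### Independent signed walks -/

theorem exists_tendsto_ultrafilter {ι X : Type*} (U : Ultrafilter ι) (g : ι → X → ℝ) {C : ℝ}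
    (hg : ∀ᶠ s in (U : Filter ι), ∀ x, |g s x| ≤ C) :
    ∃ φ : X → ℝ, (∀ x, |φ x| ≤ C) ∧ ∀ x, Tendsto (fun s => g s x) U (𝓝 (φ x)) := by
  have h : ∀ x, ∃ c, |c| ≤ C ∧ Tendsto (fun s => g s x) U (𝓝 c) := by
    intro x
    obtain ⟨c, hc, hlim⟩ := (isCompact_Icc (a := -C) (b := C)).ultrafilter_le_nhds'
      (U.map fun s => g s x) (hg.mono fun s hs => abs_le.1 (hs x))
    exact ⟨c, abs_le.2 hc, hlim⟩
  choose φ h1 h2 using h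
  exact ⟨φ, h1, h2⟩

theorem norm_sub_one_expOp_mean_le {B : Type*} [NormedAddCommGroup B] [NormedSpace ℝ B]
    [CompleteSpace B] {m : ℕ} {K : B →L[ℝ] B} {T : Fin (m + 1) → B →L[ℝ] B} (hT : ∀ i, ‖T i‖ ≤ 1)
    (hcomm : ∀ (i : Fin m) f, T 0 (T i.succ f) = T i.succ (T 0 f))
    (hK : ∀ f, K f = (1 / ((m + 1 : ℕ) : ℝ)) • ∑ i, T i f) {s : ℝ} (hs : 0 < s) (f : B) :
    ‖T 0 (expOp (K - 1) ((m + 1 : ℕ) * s) f) - expOp (K - 1) ((m + 1 : ℕ) * s) f‖ ≤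
      1 / √s * ‖f‖ := by
  set A' := (∑ i : Fin m, T i.succ) - (m : ℝ) • (1 : B →L[ℝ] B) with hA'
  have hcomm' : Commute (T 0 - 1) A' := by
    refine Commute.sub_right ?_ ((Commute.one_right _).smul_right _)
    refine Commute.sum_right _ _ _ fun i _ => ?_
    refine Commute.sub_left ?_ (Commute.one_left _)
    ext g
    exact hcomm i g
  have hsum : ((m + 1 : ℕ) * s) • (K - 1) = s • (T 0 - 1) + s • A' := by
    have hK' : K = (1 / ((m + 1 : ℕ) : ℝ)) • ∑ i, T i := by
      ext g
      rw [hK, smul_apply, sum_apply]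
    have h : ((m + 1 : ℕ) : ℝ) ≠ 0 := by positivity
    rw [hK', Fin.sum_univ_succ, mul_comm, mul_smul, smul_sub, smul_smul, ← smul_add, hA',
      mul_one_div_cancel h, one_smul]
    congr 1
    push_cast
    rw [add_smul, one_smul]
    abel
  have hexp : expOp (K - 1) ((m + 1 : ℕ) * s) f = expOp (T 0 - 1) s (expOp A' s f) := by
    let _ : NormedAlgebra ℚ (B →L[ℝ] B) := NormedAlgebra.restrictScalars ℚ ℝ _
    rw [expOp, hsum, NormedSpace.exp_add_of_commute ((hcomm'.smul_left s).smul_right s)]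
    rfl
  have hA'norm : ‖expOp A' s‖ ≤ 1 := by
    refine norm_exp_le_one _ _ s hs.le ((norm_sum_op_le _ _ (fun _ => (1 : ℝ)) fun i _ =>
      hT i.succ).trans ?_)
    simp
  rw [hexp]
  refine (norm_sub_one_expOp_le (T 0) (hT 0) hs _).trans ?_
  gcongr
  exact ((expOp A' s).le_of_opNorm_le hA'norm f).trans (one_mul _).le

theorem norm_expOp_sub_one_apply_le {B : Type*} [NormedAddCommGroup B] [NormedSpace ℝ B]
    [CompleteSpace B] {K : B →L[ℝ] B} (hK : ‖K‖ ≤ 1) {t : ℝ} (ht : 0 ≤ t) (f : B) :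
    ‖expOp (K - 1) t f‖ ≤ ‖f‖ := by
  have h := norm_exp_le_one K 1 t ht hK
  rw [one_smul] at h
  exact ((expOp (K - 1) t).le_of_opNorm_le h f).trans (one_mul _).le

theorem tendsto_one_div_sqrt_mul (c : ℝ) : Tendsto (fun s : ℝ => 1 / √s * c) atTop (𝓝 0) := by
  have h : Tendsto (fun s : ℝ => 1 / √s) atTop (𝓝 0) := by
    simp only [one_div]
    exact tendsto_inv_atTop_zero.comp Real.tendsto_sqrt_atTop
  simpa using h.mul_const c

section Walkers

variable {V : Type*} (G : SimpleGraph V) [G.LocallyFinite] (σ : Sym2 V → ℤˣ)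

/-- The signed average over the moves of the `i`-th of `m` walkers. -/
def coordOp {m : ℕ} (i : Fin m) : ((Fin m → V) → ℝ) →ₗ[ℝ] ((Fin m → V) → ℝ) where
  toFun f v := signedAverage G σ (fun y => f (Function.update v i y)) (v i)
  map_add' f g := by
    ext v
    simp only [signedAverage, Pi.add_apply, mul_add, Finset.sum_add_distrib]
  map_smul' c f := by
    ext v
    simp only [signedAverage, Pi.smul_apply, smul_eq_mul, RingHom.id_apply, Finset.mul_sum]
    exact Finset.sum_congr rfl fun y _ => by ring

theorem coordOp_apply {m : ℕ} (i : Fin m) (f : (Fin m → V) → ℝ) (v : Fin m → V) :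
    coordOp G σ i f v = signedAverage G σ (fun y => f (Function.update v i y)) (v i) := rfl

theorem abs_signedAverage_le (f g : V → ℝ) (hfg : ∀ y, |f y| ≤ g y) (x : V) :
    |signedAverage G σ f x| ≤ signedAverage G (fun _ => 1) g x := by
  rw [signedAverage, signedAverage, abs_mul, abs_of_nonneg (by positivity)]
  gcongr
  refine (Finset.abs_sum_le_sum_abs _ _).trans (Finset.sum_le_sum fun y _ => ?_)
  rw [abs_mul, abs_unit_cast]
  simpa using hfg y

theorem signedAverage_one_const {x : V} (hx : 0 < G.degree x) (C : ℝ) :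
    signedAverage G (fun _ => 1) (fun _ => C) x = C := by
  have : (G.degree x : ℝ) ≠ 0 := by exact_mod_cast hx.ne'
  simp [signedAverage, this]

theorem abs_signedAverage_le_of_bound {x : V} (hx : 0 < G.degree x) (f : V → ℝ) {C : ℝ}
    (hf : ∀ y, |f y| ≤ C) : |signedAverage G σ f x| ≤ C :=
  (abs_signedAverage_le G σ f (fun _ => C) hf x).trans (signedAverage_one_const G hx C).le

theorem tendsto_signedAverage {ι : Type*} {l : Filter ι} {f : ι → V → ℝ} {g : V → ℝ}
    (h : ∀ y, Tendsto (fun s => f s y) l (𝓝 (g y))) (x : V) :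
    Tendsto (fun s => signedAverage G σ (f s) x) l (𝓝 (signedAverage G σ g x)) :=
  (tendsto_finsetSum _ fun y _ => (h y).const_mul _).const_mul _

theorem abs_coordOp_le {m : ℕ} (i : Fin m) (f g : (Fin m → V) → ℝ) (hfg : ∀ v, |f v| ≤ g v)
    (v : Fin m → V) : |coordOp G σ i f v| ≤ coordOp G (fun _ => 1) i g v :=
  abs_signedAverage_le G σ _ _ (fun _ => hfg _) _

theorem coordOp_comm {m : ℕ} {i j : Fin m} (hij : i ≠ j) (f : (Fin m → V) → ℝ) :
    coordOp G σ i (coordOp G σ j f) = coordOp G σ j (coordOp G σ i f) := by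
  ext v
  simp only [coordOp_apply, Function.update_of_ne hij.symm, Function.update_of_ne hij]
  simp only [signedAverage, Finset.mul_sum]
  rw [Finset.sum_comm]
  refine Finset.sum_congr rfl fun z _ => Finset.sum_congr rfl fun y _ => ?_
  rw [Function.update_comm hij]
  ring

/-- The average of the moves of all walkers. -/
def meanOp (m : ℕ) : ((Fin m → V) → ℝ) →ₗ[ℝ] ((Fin m → V) → ℝ) :=
  (1 / (m : ℝ)) • ∑ i, coordOp G σ i

theorem meanOp_apply {m : ℕ} (f : (Fin m → V) → ℝ) (v : Fin m → V) :
    meanOp G σ m f v = 1 / (m : ℝ) * ∑ i, coordOp G σ i f v := by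
  simp [meanOp, LinearMap.sum_apply, Finset.sum_apply]

theorem abs_meanOp_le {m : ℕ} (f g : (Fin m → V) → ℝ) (hfg : ∀ v, |f v| ≤ g v)
    (v : Fin m → V) : |meanOp G σ m f v| ≤ meanOp G (fun _ => 1) m g v := by
  rw [meanOp_apply, meanOp_apply, abs_mul, abs_of_nonneg (by positivity)]
  gcongr
  exact (Finset.abs_sum_le_sum_abs _ _).trans
    (Finset.sum_le_sum fun i _ => abs_coordOp_le G σ i f g hfg v)

variable {G}

theorem isSupContraction_coordOp (hdeg : ∀ x, 0 < G.degree x) {m : ℕ} (i : Fin m) :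
    IsSupContraction (coordOp G σ i) := fun _ _ hf _ =>
  abs_signedAverage_le_of_bound G σ (hdeg _) _ fun _ => hf _

theorem isSupContraction_meanOp (hdeg : ∀ x, 0 < G.degree x) (m : ℕ) :
    IsSupContraction (meanOp G σ (m + 1)) := by
  intro f C hf v
  have h : ((m + 1 : ℕ) : ℝ) ≠ 0 := by positivity
  rw [meanOp_apply, abs_mul, abs_of_nonneg (by positivity)]
  calc 1 / ((m + 1 : ℕ) : ℝ) * |∑ i, coordOp G σ i f v|
      ≤ 1 / ((m + 1 : ℕ) : ℝ) * ∑ _i : Fin (m + 1), C := by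
        gcongr
        exact (Finset.abs_sum_le_sum_abs _ _).trans
          (Finset.sum_le_sum fun i _ => isSupContraction_coordOp σ hdeg i f C hf v)
    _ = C := by
        rw [Finset.sum_const, Finset.card_univ, Fintype.card_fin, nsmul_eq_mul]
        field_simp

theorem op_meanOp_apply (hdeg : ∀ x, 0 < G.degree x) (m : ℕ)
    (f : lp (fun _ : Fin (m + 1) → V => ℝ) ∞) :
    (isSupContraction_meanOp σ hdeg m).op f =
      (1 / ((m + 1 : ℕ) : ℝ)) • ∑ i, (isSupContraction_coordOp σ hdeg i).op f := by
  ext v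
  rw [IsSupContraction.op_apply, meanOp_apply, ← evalLp_apply, map_smul, map_sum]
  rfl

/-- The semigroup of independent signed walks asymptotically does not see the steps of the first
walker. -/
theorem abs_coordOp_sub_expOp_le (hdeg : ∀ x, 0 < G.degree x) (m : ℕ) {s : ℝ} (hs : 0 < s)
    (f : lp (fun _ : Fin (m + 1) → V => ℝ) ∞) (v : Fin (m + 1) → V) :
    |coordOp G σ 0 ⇑(expOp ((isSupContraction_meanOp σ hdeg m).op - 1) ((m + 1 : ℕ) * s) f) v -
      expOp ((isSupContraction_meanOp σ hdeg m).op - 1) ((m + 1 : ℕ) * s) f v| ≤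
      1 / √s * ‖f‖ := by
  refine (abs_apply_le_norm ((isSupContraction_coordOp σ hdeg 0).op (expOp
    ((isSupContraction_meanOp σ hdeg m).op - 1) ((m + 1 : ℕ) * s) f) - expOp
    ((isSupContraction_meanOp σ hdeg m).op - 1) ((m + 1 : ℕ) * s) f) v).trans ?_
  refine norm_sub_one_expOp_mean_le (T := fun i => (isSupContraction_coordOp σ hdeg i).op)
    (fun i => (isSupContraction_coordOp σ hdeg i).norm_op_le) (fun i g => ?_)
    (op_meanOp_apply σ hdeg m) hs f
  ext w
  exact congrFun (coordOp_comm G σ (Fin.succ_ne_zero i).symm g) w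

/-- A graph with signs has the Liouville property for signed walks: bounded harmonic functions of the
signed walk vanish. -/
def SignedLiouville (G : SimpleGraph V) [G.LocallyFinite] (σ : Sym2 V → ℤˣ) : Prop :=
  ∀ (u : V → ℝ) (C : ℝ), (∀ x, |u x| ≤ C) → (∀ x, signedAverage G σ u x = u x) → ∀ x, u x = 0

theorem tendsto_expOp_meanOp (hdeg : ∀ x, 0 < G.degree x) (hL : SignedLiouville G σ) (m : ℕ)
    (f : lp (fun _ : Fin (m + 1) → V => ℝ) ∞) (v : Fin (m + 1) → V) :
    Tendsto (fun t : ℝ => expOp ((isSupContraction_meanOp σ hdeg m).op - 1) t f v) atTop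
      (𝓝 0) := by
  have hm : (0 : ℝ) < (m + 1 : ℕ) := by positivity
  suffices h : Tendsto (fun s : ℝ => expOp ((isSupContraction_meanOp σ hdeg m).op - 1)
      ((m + 1 : ℕ) * s) f v) atTop (𝓝 0) by
    refine (h.comp (tendsto_id.atTop_div_const hm)).congr fun t => ?_
    simp only [Function.comp_apply, id]
    rw [mul_div_cancel₀ _ hm.ne']
  rw [tendsto_iff_ultrafilter]
  intro U hU
  obtain ⟨φ, hφ, hlim⟩ := exists_tendsto_ultrafilter U (C := ‖f‖)
    (fun s : ℝ => ⇑(expOp ((isSupContraction_meanOp σ hdeg m).op - 1) ((m + 1 : ℕ) * s) f)) (by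
      refine hU ((eventually_ge_atTop (0 : ℝ)).mono fun s hs w => ?_)
      exact (abs_apply_le_norm _ w).trans (norm_expOp_sub_one_apply_le
        (isSupContraction_meanOp σ hdeg m).norm_op_le (by positivity) f))
  have hharm : ∀ w, coordOp G σ 0 φ w = φ w := by
    intro w
    have h1 := (tendsto_signedAverage G σ (fun y => hlim (Function.update w 0 y)) (w 0)).sub (hlim w)
    have h4 : Tendsto (fun s : ℝ => coordOp G σ 0 ⇑(expOp ((isSupContraction_meanOp σ hdeg m).op - 1)
        ((m + 1 : ℕ) * s) f) w - expOp ((isSupContraction_meanOp σ hdeg m).op - 1)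
        ((m + 1 : ℕ) * s) f w) atTop (𝓝 0) :=
      squeeze_zero_norm' ((eventually_gt_atTop (0 : ℝ)).mono fun s hs =>
        abs_coordOp_sub_expOp_le σ hdeg m hs f w) (tendsto_one_div_sqrt_mul _)
    exact sub_eq_zero.1 (tendsto_nhds_unique h1 (h4.mono_left hU))
  have hzero : φ v = 0 := by
    have h := hL (fun y => φ (Function.update v 0 y)) ‖f‖ (fun y => hφ _) (fun y => by
      have := hharm (Function.update v 0 y)
      simpa [coordOp_apply, Function.update_idem] using this) (v 0)
    simpa using h
  rw [← hzero]
  exact hlim v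

end Walkers

/-! ### Bounded harmonic functions of the annihilating walks -/

section Annihilating

variable {V : Type*} [DecidableEq V] {G : SimpleGraph V} [G.LocallyFinite] {σ : Sym2 V → ℤˣ}

/-- The generator of the annihilating signed walks, the dual process of the signed voter model. -/
def dualGenerator (G : SimpleGraph V) [G.LocallyFinite] (σ : Sym2 V → ℤˣ) (w : Finset V → ℝ)
    (A : Finset V) : ℝ :=
  ∑ x ∈ A, (signedAverage G σ (fun y => w (symmDiff (A.erase x) {y})) x - w A)

theorem symmDiff_singleton_of_mem {A : Finset V} {y : V} (hy : y ∈ A) :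
    symmDiff A {y} = A.erase y := by
  ext z
  simp only [Finset.mem_symmDiff, Finset.mem_singleton, Finset.mem_erase]
  grind

theorem symmDiff_singleton_of_notMem {A : Finset V} {y : V} (hy : y ∉ A) :
    symmDiff A {y} = insert y A := by
  ext z
  simp only [Finset.mem_symmDiff, Finset.mem_singleton, Finset.mem_insert]
  grind

open Classical in
/-- A function of finite sets, as a function of tuples of distinct points. -/
def onTuples (w : Finset V → ℝ) (m : ℕ) (v : Fin m → V) : ℝ :=
  if Function.Injective v then w (Finset.univ.image v) else 0

theorem onTuples_update {w : Finset V → ℝ} {m : ℕ} (hw : ∀ A : Finset V, A.card < m → w A = 0)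
    {v : Fin m → V} (hv : Function.Injective v) (i : Fin m) (y : V) :
    onTuples w m (Function.update v i y) =
      w (symmDiff ((Finset.univ.image v).erase (v i)) {y}) := by
  have himage : (Finset.univ.image v).erase (v i) = (Finset.univ.erase i).image v := by
    rw [Finset.image_erase hv]
  have hcard : ((Finset.univ.image v).erase (v i)).card = m - 1 := by
    rw [Finset.card_erase_of_mem (Finset.mem_image_of_mem v (Finset.mem_univ i)),
      Finset.card_image_of_injective _ hv, Finset.card_univ, Fintype.card_fin]
  by_cases hy : y ∈ (Finset.univ.image v).erase (v i)
  · rw [symmDiff_singleton_of_mem hy, hw, onTuples, if_neg]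
    · rw [himage] at hy
      obtain ⟨j, hj, rfl⟩ := Finset.mem_image.1 hy
      have hji : j ≠ i := (Finset.mem_erase.1 hj).1
      intro hinj
      exact hji (hinj (by rw [Function.update_self, Function.update_of_ne hji]))
    · refine (Finset.card_erase_lt_of_mem hy).trans_le ?_
      rw [hcard]
      exact Nat.sub_le _ _
  · rw [symmDiff_singleton_of_notMem hy, onTuples, if_pos]
    · congr 1
      rw [himage]
      ext z
      simp only [Finset.mem_image, Finset.mem_univ, true_and, Finset.mem_insert, Finset.mem_erase]
      constructor
      · rintro ⟨j, rfl⟩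
        by_cases hji : j = i
        · subst hji
          exact Or.inl (Function.update_self ..)
        · exact Or.inr ⟨j, ⟨hji, trivial⟩, (Function.update_of_ne hji ..).symm⟩
      · rintro (rfl | ⟨j, ⟨hji, -⟩, rfl⟩)
        · exact ⟨i, Function.update_self ..⟩
        · exact ⟨j, Function.update_of_ne hji ..⟩
    · rw [himage] at hy
      intro j k hjk
      by_contra hne
      by_cases hji : j = i
      · subst hji
        rw [Function.update_self, Function.update_of_ne (Ne.symm hne)] at hjk
        exact hy (Finset.mem_image.2 ⟨k, Finset.mem_erase.2 ⟨Ne.symm hne, Finset.mem_univ k⟩,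
          hjk.symm⟩)
      · by_cases hki : k = i
        · subst hki
          rw [Function.update_self, Function.update_of_ne hji] at hjk
          exact hy (Finset.mem_image.2 ⟨j, Finset.mem_erase.2 ⟨hji, Finset.mem_univ j⟩, hjk⟩)
        · rw [Function.update_of_ne hji, Function.update_of_ne hki] at hjk
          exact hne (hv hjk)

theorem meanOp_onTuples {w : Finset V → ℝ} (hharm : ∀ A, dualGenerator G σ w A = 0) {m : ℕ}
    (hw : ∀ A : Finset V, A.card < m + 1 → w A = 0) {v : Fin (m + 1) → V}
    (hv : Function.Injective v) :
    meanOp G σ (m + 1) (onTuples w (m + 1)) v = onTuples w (m + 1) v := by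
  have h1 := hharm (Finset.univ.image v)
  rw [dualGenerator, Finset.sum_image fun i _ j _ h => hv h, Finset.sum_sub_distrib,
    Finset.sum_const, Finset.card_univ, Fintype.card_fin, nsmul_eq_mul, sub_eq_zero] at h1
  have h2 : ∀ i, coordOp G σ i (onTuples w (m + 1)) v = signedAverage G σ
      (fun y => w (symmDiff ((Finset.univ.image v).erase (v i)) {y})) (v i) := by
    intro i
    rw [coordOp_apply]
    simp only [onTuples_update hw hv]
  rw [meanOp_apply]
  simp only [h2]
  rw [h1, onTuples, if_pos hv]
  have h : ((m + 1 : ℕ) : ℝ) ≠ 0 := by positivity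
  field_simp

theorem eq_zero_of_dualGenerator_eq_zero (hdeg : ∀ x, 0 < G.degree x)
    (hL : SignedLiouville G σ) {w : Finset V → ℝ} {C : ℝ} (hC : ∀ A, |w A| ≤ C) (h0 : w ∅ = 0)
    (hharm : ∀ A, dualGenerator G σ w A = 0) (A : Finset V) : w A = 0 := by
  induction hcard : A.card using Nat.strong_induction_on generalizing A with
  | _ m ih =>
  rcases m with _ | m
  · rw [Finset.card_eq_zero.1 hcard, h0]
  have hw : ∀ B : Finset V, B.card < m + 1 → w B = 0 := fun B hB => ih B.card hB B rfl
  have hhalf : ∀ C, (∀ v, |onTuples w (m + 1) v| ≤ C) → ∀ v, |onTuples w (m + 1) v| ≤ C / 2 := by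
    intro C hC
    refine abs_le_half_of_tendsto (isSupContraction_meanOp σ hdeg m)
      (isSupContraction_meanOp (fun _ => 1) hdeg m) (abs_meanOp_le G σ) (onTuples w (m + 1)) C hC
      (fun v => ?_) fun v => tendsto_expOp_meanOp σ hdeg hL m _ v
    have h1 := abs_meanOp_le G σ (onTuples w (m + 1)) (fun v => |onTuples w (m + 1) v|)
      (fun _ => le_rfl) v
    by_cases hv : Function.Injective v
    · rw [meanOp_onTuples hharm hw hv] at h1 ⊢
      simpa using h1
    · have h2 : onTuples w (m + 1) v = 0 := if_neg hv
      rw [h2, zero_sub, abs_neg, abs_zero, sub_zero]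
      exact h1
  have hC0 : 0 ≤ C := (abs_nonneg _).trans (hC ∅)
  have hpow : ∀ k : ℕ, ∀ v, |onTuples w (m + 1) v| ≤ C * (1 / 2) ^ k := by
    intro k
    induction k with
    | zero =>
      intro v
      rw [onTuples]
      split_ifs
      · simpa using hC _
      · simpa using hC0
    | succ k ihk =>
      intro v
      refine (hhalf _ ihk v).trans (le_of_eq ?_)
      ring
  let e := A.equivFinOfCardEq hcard
  have hinj : Function.Injective fun i => ((e.symm i : A) : V) :=
    Subtype.val_injective.comp e.symm.injective
  have himage : Finset.univ.image (fun i => ((e.symm i : A) : V)) = A := by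
    ext z
    simp only [Finset.mem_image, Finset.mem_univ, true_and]
    constructor
    · rintro ⟨i, rfl⟩
      exact (e.symm i).2
    · exact fun hz => ⟨e ⟨z, hz⟩, by simp⟩
  have hval : onTuples w (m + 1) (fun i => ((e.symm i : A) : V)) = w A := by
    rw [onTuples, if_pos hinj, himage]
  have hlim : Tendsto (fun k : ℕ => C * (1 / 2 : ℝ) ^ k) atTop (𝓝 0) := by
    simpa using (tendsto_pow_atTop_nhds_zero_of_lt_one (r := (1 / 2 : ℝ)) (by norm_num)
      (by norm_num)).const_mul C
  have hle := ge_of_tendsto hlim (Eventually.of_forall fun k =>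
    hpow k fun i => ((e.symm i : A) : V))
  rw [hval] at hle
  exact abs_nonpos_iff.1 hle

end Annihilating

/-! ### Linear differential equations that hold coordinatewise -/

theorem hasDerivAt_expOp_apply {B : Type*} [NormedAddCommGroup B] [NormedSpace ℝ B]
    [CompleteSpace B] (L : B →L[ℝ] B) (t : ℝ) (f : B) :
    HasDerivAt (fun s => expOp L s f) (L (expOp L t f)) t :=
  ((ContinuousLinearMap.apply ℝ B f).hasFDerivAt.comp_hasDerivAt t
    (hasDerivAt_exp_smul_const' L t))

theorem eq_expOp_of_hasDerivWithinAt {B ι : Type*} [NormedAddCommGroup B] [NormedSpace ℝ B]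
    [CompleteSpace B] (l : ι → B →L[ℝ] ℝ)
    (hl : ∀ b c, 0 ≤ c → (∀ i, |l i b| ≤ c) → ‖b‖ ≤ c) (hl' : ∀ i b, |l i b| ≤ ‖b‖)
    (K : B →L[ℝ] B) (hK : ‖K‖ ≤ 1) {c : ℝ} (hc : 0 ≤ c) (ψ : ℝ → B) {M : ℝ} (hM : ∀ t, ‖ψ t‖ ≤ M)
    (hcont : ∀ i, ContinuousOn (fun s => l i (ψ s)) (Set.Ici 0))
    (hder : ∀ i t, 0 ≤ t →
      HasDerivWithinAt (fun s => l i (ψ s)) (c * l i (K (ψ t) - ψ t)) (Set.Ici t) t)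
    {t : ℝ} (ht : 0 ≤ t) : ψ t = expOp (K - 1) (c * t) (ψ 0) := by
  have hM0 : 0 ≤ M := (norm_nonneg _).trans (hM 0)
  have hder2 : ∀ i s, HasDerivAt (fun s => l i (expOp (K - 1) (c * s) (ψ 0)))
      (c * l i (K (expOp (K - 1) (c * s) (ψ 0)) - expOp (K - 1) (c * s) (ψ 0))) s := by
    intro i s
    have h1 : HasDerivAt (fun s : ℝ => c * s) c s := by
      simpa using (hasDerivAt_id s).const_mul c
    have h2 := (hasDerivAt_expOp_apply (K - 1) (c * s) (ψ 0)).scomp s h1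
    have h3 := (l i).hasFDerivAt.comp_hasDerivAt s h2
    rw [map_smul, smul_eq_mul] at h3
    exact h3
  have hpic : ∀ k : ℕ, ∀ s, 0 ≤ s → ‖ψ s - expOp (K - 1) (c * s) (ψ 0)‖ ≤
      2 * M * ((2 * c * s) ^ k / k.factorial) := by
    intro k
    induction k with
    | zero =>
      intro s hs
      refine (norm_sub_le _ _).trans ?_
      have h1 := norm_expOp_sub_one_apply_le hK (mul_nonneg hc hs) (ψ 0)
      have h2 := hM s
      have h3 := hM 0
      simp only [pow_zero, Nat.factorial_zero, Nat.cast_one, div_one, mul_one]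
      linarith
    | succ k ih =>
      intro s hs
      refine hl _ _ (by positivity) fun i => ?_
      have h := image_norm_le_of_norm_deriv_right_le_deriv_boundary
        (f := fun s => l i (ψ s - expOp (K - 1) (c * s) (ψ 0)))
        (f' := fun s => c * l i (K (ψ s - expOp (K - 1) (c * s) (ψ 0)) -
          (ψ s - expOp (K - 1) (c * s) (ψ 0))))
        (a := 0) (b := s) (B := fun s => 2 * M * ((2 * c * s) ^ (k + 1) / (k + 1).factorial))
        (B' := fun s => 2 * c * (2 * M * ((2 * c * s) ^ k / k.factorial)))
        ?_ ?_ ?_ ?_ ?_ (Set.right_mem_Icc.2 hs)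
      · exact h
      · simp only [map_sub]
        exact ((hcont i).mono Set.Icc_subset_Ici_self).sub
          (fun r _ => (hder2 i r).continuousAt.continuousWithinAt)
      · intro r hr
        have h1 := (hder i r hr.1).sub (hder2 i r).hasDerivWithinAt
        simp only [map_sub] at h1 ⊢
        refine h1.congr_deriv ?_
        ring
      · simp [expOp]
      · intro r
        have h1 : HasDerivAt (fun r : ℝ => 2 * c * r) (2 * c) r := by
          simpa using (hasDerivAt_id r).const_mul (2 * c)
        refine (((h1.pow (k + 1)).div_const ((k + 1).factorial : ℝ)).const_mul (2 * M)).congr_deriv ?_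
        rw [Nat.factorial_succ]
        push_cast
        have : (k.factorial : ℝ) ≠ 0 := by positivity
        have h2 : (k : ℝ) + 1 ≠ 0 := by positivity
        field_simp
      · intro r hr
        rw [Real.norm_eq_abs, abs_mul, abs_of_nonneg hc]
        have h1 := ih r hr.1
        have h2 : ‖K (ψ r - expOp (K - 1) (c * r) (ψ 0)) - (ψ r - expOp (K - 1) (c * r) (ψ 0))‖ ≤
            2 * ‖ψ r - expOp (K - 1) (c * r) (ψ 0)‖ := by
          refine (norm_sub_le _ _).trans ?_
          have := K.le_of_opNorm_le hK (ψ r - expOp (K - 1) (c * r) (ψ 0))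
          linarith
        calc c * |l i (K (ψ r - expOp (K - 1) (c * r) (ψ 0)) - (ψ r - expOp (K - 1) (c * r) (ψ 0)))|
            ≤ c * (2 * (2 * M * ((2 * c * r) ^ k / k.factorial))) := by
              gcongr
              exact (hl' _ _).trans (h2.trans (by linarith))
          _ = _ := by ring
  have hlim : Tendsto (fun k : ℕ => 2 * M * ((2 * c * t) ^ k / k.factorial)) atTop (𝓝 0) := by
    simpa using (FloorSemiring.tendsto_pow_div_factorial_atTop (2 * c * t)).const_mul (2 * M)
  have h0 := ge_of_tendsto hlim (Eventually.of_forall fun k => hpic k t ht)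
  exact sub_eq_zero.1 (norm_le_zero_iff.1 h0)

/-! ### Duality -/

section Duality

variable {V : Type*}

/-- The product of the spins in `A`. -/
def spinProd (A : Finset V) : C(Config V, ℝ) where
  toFun η := (((∏ x ∈ A, η x : ℤˣ) : ℤ) : ℝ)
  continuous_toFun := by
    have h : Continuous fun η : Config V => ∏ x ∈ A, η x :=
      continuous_finsetProd _ fun x _ => continuous_apply x
    exact (continuous_of_discreteTopology (f := fun u : ℤˣ => ((u : ℤ) : ℝ))).comp h

theorem spinProd_apply (A : Finset V) (η : Config V) :
    spinProd A η = (((∏ x ∈ A, η x : ℤˣ) : ℤ) : ℝ) := rfl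

theorem abs_spinProd (A : Finset V) (η : Config V) : |spinProd A η| = 1 := abs_unit_cast _

theorem dependsOn_spinProd (A : Finset V) : DependsOn (spinProd A) (A : Set V) := by
  intro η ξ h
  rw [spinProd_apply, spinProd_apply, Finset.prod_congr rfl fun x hx => h x hx]

variable [DecidableEq V]

theorem spinProd_symmDiff_singleton (A : Finset V) (y : V) (η : Config V) :
    spinProd (symmDiff A {y}) η = ((η y : ℤ) : ℝ) * spinProd A η := by
  by_cases hy : y ∈ A
  · have h : ((η y : ℤ) : ℝ) * ((η y : ℤ) : ℝ) = 1 := by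
      rw [← Int.cast_mul, ← Units.val_mul, Int.units_mul_self]
      simp
    rw [symmDiff_singleton_of_mem hy, spinProd_apply, spinProd_apply, ← Finset.mul_prod_erase A _ hy]
    push_cast
    rw [← mul_assoc, h, one_mul]
  · rw [symmDiff_singleton_of_notMem hy, spinProd_apply, spinProd_apply, Finset.prod_insert hy]
    push_cast
    rfl

variable {G : SimpleGraph V} [G.LocallyFinite] {σ : Sym2 V → ℤˣ}

theorem spinProd_updMap {A : Finset V} {x : V} (hx : x ∈ A) (y : V) (η : Config V) :
    spinProd A (updMap σ x y η) =
      ((σ s(x, y) : ℤ) : ℝ) * spinProd (symmDiff (A.erase x) {y}) η := by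
  rw [spinProd_symmDiff_singleton, spinProd_apply, spinProd_apply]
  change (((∏ z ∈ A, Function.update η x (σ s(x, y) * η y) z : ℤˣ) : ℤ) : ℝ) = _
  rw [Finset.prod_update_of_mem hx, Finset.sdiff_singleton_eq_erase]
  push_cast
  ring

theorem map_volOp_spinProd (hdeg : ∀ x, 0 < G.degree x) (A : Finset V)
    (I : C(Config V, ℝ) →ₗ[ℝ] ℝ) :
    I (volOp G σ A (spinProd A)) = dualGenerator G σ (fun B => I (spinProd B)) A := by
  simp only [volOp, sum_apply, map_sum, dualGenerator]
  refine Finset.sum_congr rfl fun x hx => ?_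
  have hd : (G.degree x : ℝ) ≠ 0 := by exact_mod_cast (hdeg x).ne'
  have h1 : siteOp G σ x (spinProd A) = (∑ y ∈ G.neighborFinset x, (1 / (G.degree x : ℝ)) •
      (((σ s(x, y) : ℤ) : ℝ) • spinProd (symmDiff (A.erase x) {y}))) - spinProd A := by
    have h2 : spinProd A = ∑ y ∈ G.neighborFinset x, (1 / (G.degree x : ℝ)) • spinProd A := by
      rw [Finset.sum_const, SimpleGraph.card_neighborFinset_eq_degree, ← Nat.cast_smul_eq_nsmul ℝ,
        smul_smul, mul_one_div_cancel hd, one_smul]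
    conv_rhs => rw [h2]
    rw [← Finset.sum_sub_distrib, siteOp, sum_apply]
    refine Finset.sum_congr rfl fun y _ => ?_
    rw [smul_apply, sub_apply, one_apply_eq_self, smul_sub]
    congr 2
    ext η
    exact spinProd_updMap hx y η
  rw [h1, map_sub, map_sum, signedAverage, Finset.mul_sum]
  simp only [map_smul, smul_eq_mul]

theorem card_symmDiff_erase_le {A : Finset V} {x : V} (hx : x ∈ A) (y : V) :
    (symmDiff (A.erase x) {y}).card ≤ A.card := by
  by_cases hy : y ∈ A.erase x
  · rw [symmDiff_singleton_of_mem hy]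
    exact (Finset.card_erase_le).trans (Finset.card_erase_le)
  · rw [symmDiff_singleton_of_notMem hy, Finset.card_insert_of_notMem hy,
      Finset.card_erase_add_one hx]

theorem dualGenerator_congr {w w' : Finset V → ℝ} {n : ℕ}
    (h : ∀ B : Finset V, B.card ≤ n → w B = w' B) {A : Finset V} (hA : A.card ≤ n) :
    dualGenerator G σ w A = dualGenerator G σ w' A := by
  refine Finset.sum_congr rfl fun x hx => ?_
  rw [h A hA, signedAverage, signedAverage]
  congr 2
  exact Finset.sum_congr rfl fun y _ => by rw [h _ ((card_symmDiff_erase_le hx y).trans hA)]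

theorem dualGenerator_add (w w' : Finset V → ℝ) (A : Finset V) :
    dualGenerator G σ (w + w') A = dualGenerator G σ w A + dualGenerator G σ w' A := by
  simp only [dualGenerator, ← Finset.sum_add_distrib]
  refine Finset.sum_congr rfl fun x _ => ?_
  simp only [signedAverage, Pi.add_apply, mul_add, Finset.sum_add_distrib]
  ring

theorem dualGenerator_smul (c : ℝ) (w : Finset V → ℝ) (A : Finset V) :
    dualGenerator G σ (c • w) A = c * dualGenerator G σ w A := by
  simp only [dualGenerator, signedAverage, Pi.smul_apply, smul_eq_mul, Finset.mul_sum]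
  refine Finset.sum_congr rfl fun x _ => ?_
  rw [mul_sub, Finset.mul_sum]
  congr 1
  exact Finset.sum_congr rfl fun _ _ => by ring

theorem tendsto_dualGenerator {ι : Type*} {l : Filter ι} {f : ι → Finset V → ℝ}
    {w : Finset V → ℝ} (h : ∀ B, Tendsto (fun s => f s B) l (𝓝 (w B))) (A : Finset V) :
    Tendsto (fun s => dualGenerator G σ (f s) A) l (𝓝 (dualGenerator G σ w A)) :=
  tendsto_finsetSum _ fun x _ => (tendsto_signedAverage G σ (fun _ => h _) x).sub (h A)

variable (G σ) in
/-- A uniformisation of the annihilating walks, frozen on sets of more than `n` points. -/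
def dualStep (n : ℕ) : (Finset V → ℝ) →ₗ[ℝ] (Finset V → ℝ) where
  toFun w A := w A + if A.card ≤ n then 1 / ((n + 1 : ℕ) : ℝ) * dualGenerator G σ w A else 0
  map_add' w w' := by
    ext A
    simp only [Pi.add_apply, dualGenerator_add]
    split_ifs <;> ring
  map_smul' c w := by
    ext A
    simp only [Pi.smul_apply, smul_eq_mul, dualGenerator_smul, RingHom.id_apply]
    split_ifs <;> ring

theorem dualStep_apply (n : ℕ) (w : Finset V → ℝ) (A : Finset V) : dualStep G σ n w A =
    w A + if A.card ≤ n then 1 / ((n + 1 : ℕ) : ℝ) * dualGenerator G σ w A else 0 := rfl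

theorem isSupContraction_dualStep (hdeg : ∀ x, 0 < G.degree x) (n : ℕ) :
    IsSupContraction (dualStep G σ n) := by
  intro w C hw A
  rw [dualStep_apply]
  split_ifs with hA
  swap
  · simpa using hw A
  have hn : (0 : ℝ) < ((n + 1 : ℕ) : ℝ) := by positivity
  have hA' : (A.card : ℝ) ≤ ((n + 1 : ℕ) : ℝ) := by exact_mod_cast hA.trans (Nat.le_succ n)
  have h1 : w A + 1 / ((n + 1 : ℕ) : ℝ) * dualGenerator G σ w A =
      1 / ((n + 1 : ℕ) : ℝ) * ((((n + 1 : ℕ) : ℝ) - A.card) * w A +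
        ∑ x ∈ A, signedAverage G σ (fun y => w (symmDiff (A.erase x) {y})) x) := by
    rw [dualGenerator, Finset.sum_sub_distrib, Finset.sum_const, nsmul_eq_mul]
    field_simp
    ring
  rw [h1, abs_mul, abs_of_nonneg (by positivity)]
  have h2 : |∑ x ∈ A, signedAverage G σ (fun y => w (symmDiff (A.erase x) {y})) x| ≤ A.card * C := by
    refine (Finset.abs_sum_le_sum_abs _ _).trans ?_
    rw [← nsmul_eq_mul]
    exact Finset.sum_le_card_nsmul _ _ _ fun x _ =>
      abs_signedAverage_le_of_bound G σ (hdeg x) _ fun _ => hw _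
  have h3 : |(((n + 1 : ℕ) : ℝ) - A.card) * w A| ≤ (((n + 1 : ℕ) : ℝ) - A.card) * C := by
    rw [abs_mul, abs_of_nonneg (by linarith)]
    exact mul_le_mul_of_nonneg_left (hw A) (by linarith)
  have h4 := abs_add_le ((((n + 1 : ℕ) : ℝ) - A.card) * w A)
    (∑ x ∈ A, signedAverage G σ (fun y => w (symmDiff (A.erase x) {y})) x)
  rw [one_div, inv_mul_le_iff₀ hn]
  linarith

end Duality

/-! ### The evolution of the correlations -/

section Evolution

variable {V : Type*}

theorem abs_expectation_le (μ : Measure (Config V)) [IsProbabilityMeasure μ] (f : Config V → ℝ)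
    {C : ℝ} (hf : ∀ ξ, |f ξ| ≤ C) : |∫ ξ, f ξ ∂μ| ≤ C := by
  have h := norm_integral_le_of_norm_le_const (μ := μ) (f := f) (Eventually.of_forall hf)
  simpa using h

/-- The expectation of the product of the spins in `A` at time `t`. -/
def correlation (P : ℝ≥0 → Kernel (Config V) (Config V)) (η : Config V) (t : ℝ) (A : Finset V) : ℝ :=
  ∫ ξ, spinProd A ξ ∂(P t.toNNReal η)

theorem abs_correlation_le {P : ℝ≥0 → Kernel (Config V) (Config V)} [∀ t, IsMarkovKernel (P t)]
    (η : Config V) (t : ℝ) (A : Finset V) : |correlation P η t A| ≤ 1 :=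
  abs_expectation_le _ _ fun ξ => (abs_spinProd A ξ).le

/-- The correlations of at most `n` spins. -/
def truncatedCorrelation (P : ℝ≥0 → Kernel (Config V) (Config V)) [∀ t, IsMarkovKernel (P t)]
    (η : Config V) (n : ℕ) (t : ℝ) : lp (fun _ : Finset V => ℝ) ∞ :=
  toLp (fun A => if A.card ≤ n then correlation P η t A else 0) 1 fun A => by
    split_ifs
    · exact abs_correlation_le η t A
    · simp

theorem dualGenerator_truncatedCorrelation [DecidableEq V] {G : SimpleGraph V} [G.LocallyFinite]
    {σ : Sym2 V → ℤˣ} {P : ℝ≥0 → Kernel (Config V) (Config V)} [∀ t, IsMarkovKernel (P t)]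
    (η : Config V) {n : ℕ} (t : ℝ) {A : Finset V}
    (hA : A.card ≤ n) : dualGenerator G σ ⇑(truncatedCorrelation P η n t) A =
      dualGenerator G σ (correlation P η t) A :=
  dualGenerator_congr (fun _ hB => if_pos hB) hA

variable [Countable V]

theorem integrable_continuousMap (μ : Measure (Config V)) [IsFiniteMeasure μ]
    (f : C(Config V, ℝ)) : Integrable f μ :=
  Integrable.of_bound f.continuous.aestronglyMeasurable ‖f‖
    (Eventually.of_forall fun ξ => f.norm_coe_le_norm ξ)

/-- The expectation with respect to `μ`, as a functional on continuous functions. -/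
def expectation (μ : Measure (Config V)) [IsFiniteMeasure μ] : C(Config V, ℝ) →ₗ[ℝ] ℝ where
  toFun f := ∫ ξ, f ξ ∂μ
  map_add' f g := integral_add (integrable_continuousMap μ f) (integrable_continuousMap μ g)
  map_smul' c f := integral_const_mul c f

theorem expectation_apply (μ : Measure (Config V)) [IsFiniteMeasure μ] (f : C(Config V, ℝ)) :
    expectation μ f = ∫ ξ, f ξ ∂μ := rfl

variable {P : ℝ≥0 → Kernel (Config V) (Config V)} [∀ t, IsMarkovKernel (P t)]

theorem IsFellerSemigroup.integral_add (hP : IsFellerSemigroup P) (s t : ℝ≥0) (f : C(Config V, ℝ))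
    (η : Config V) : ∫ ξ, f ξ ∂(P (s + t) η) = ∫ ξ, ∫ ζ, f ζ ∂(P t ξ) ∂(P s η) := by
  rw [hP.add, Kernel.integral_comp]
  exact integrable_continuousMap _ f

theorem IsFellerSemigroup.integral_add_sub (hP : IsFellerSemigroup P) (s t : ℝ≥0)
    (f : C(Config V, ℝ)) (η : Config V) :
    ∫ ξ, f ξ ∂(P (s + t) η) - ∫ ξ, f ξ ∂(P s η) =
      ∫ ξ, (∫ ζ, f ζ ∂(P t ξ) - f ξ) ∂(P s η) := by
  rw [hP.integral_add]
  exact (integral_sub (integrable_continuousMap (P s η) ⟨_, hP.feller t f⟩)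
    (integrable_continuousMap _ f)).symm

theorem IsFellerSemigroup.continuous_integral (hP : IsFellerSemigroup P) (f : C(Config V, ℝ))
    (η : Config V) : Continuous fun t => ∫ ξ, f ξ ∂(P t η) := by
  rw [Metric.continuous_iff]
  intro s ε hε
  have h1 := Metric.tendstoUniformly_iff.1 (hP.tendsto_zero f) (ε / 2) (by positivity)
  obtain ⟨δ, hδ, hball⟩ := Metric.eventually_nhds_iff.1 h1
  have key : ∀ r u : ℝ≥0, r ≤ u → dist u r < δ →
      dist (∫ ξ, f ξ ∂(P u η)) (∫ ξ, f ξ ∂(P r η)) ≤ ε / 2 := by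
    intro r u hru hd
    have h2 : dist (u - r) 0 < δ := by
      rw [NNReal.dist_eq, NNReal.coe_sub hru, NNReal.coe_zero, sub_zero, ← NNReal.dist_eq]
      exact hd
    rw [Real.dist_eq]
    have h3 := hP.integral_add_sub r (u - r) f η
    rw [add_tsub_cancel_of_le hru] at h3
    rw [h3]
    refine abs_expectation_le _ _ fun ξ => ?_
    have := hball h2 ξ
    rw [dist_comm, Real.dist_eq] at this
    exact this.le
  refine ⟨δ, hδ, fun t ht => ?_⟩
  rcases le_total s t with h | h
  · exact (key s t h ht).trans_lt (by linarith)
  · rw [dist_comm] at ht ⊢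
    exact (key t s h ht).trans_lt (by linarith)

variable [DecidableEq V] {G : SimpleGraph V} [G.LocallyFinite] {σ : Sym2 V → ℤˣ}

theorem IsSignedVoterModel.hasDerivWithinAt (hP : IsSignedVoterModel G σ P) {A : Finset V}
    {f : C(Config V, ℝ)} (hf : DependsOn f (A : Set V)) (η : Config V) {t : ℝ} (ht : 0 ≤ t) :
    HasDerivWithinAt (fun s : ℝ => ∫ ξ, f ξ ∂(P s.toNNReal η))
      (∫ ξ, volOp G σ A f ξ ∂(P t.toNNReal η)) (Set.Ici t) t := by
  rw [← hasDerivWithinAt_Ioi_iff_Ici, hasDerivWithinAt_iff_tendsto_slope' (by simp),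
    Metric.tendsto_nhds]
  intro ε hε
  have h1 := Metric.tendstoUniformly_iff.1 (hP.generator f ⟨A, hf⟩) (ε / 2) (by positivity)
  have h2 : Tendsto (fun s : ℝ => (s - t).toNNReal) (𝓝[>] t) (𝓝[>] 0) := by
    refine tendsto_nhdsWithin_iff.2 ⟨?_, ?_⟩
    · have h3 : Continuous fun s : ℝ => (s - t).toNNReal := by fun_prop
      have h4 := h3.tendsto t
      simp only [sub_self, Real.toNNReal_zero] at h4
      exact h4.mono_left nhdsWithin_le_nhds
    · filter_upwards [self_mem_nhdsWithin] with s hs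
      exact Real.toNNReal_pos.2 (sub_pos.2 hs)
  filter_upwards [h2.eventually h1, self_mem_nhdsWithin] with s hs hts
  have hts' : 0 < s - t := sub_pos.2 hts
  have h3 : s.toNNReal = t.toNNReal + (s - t).toNNReal := by
    rw [← Real.toNNReal_add ht hts'.le]
    congr 1
    ring
  rw [slope_def_field, h3, hP.toIsFellerSemigroup.integral_add_sub, ← integral_div, Real.dist_eq,
    ← integral_sub]
  · refine (abs_expectation_le _ _ (C := ε / 2) fun ξ => ?_).trans_lt (by linarith)
    have h4 := hs ξ
    rw [dist_comm, Real.dist_eq, Real.coe_toNNReal _ hts'.le,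
      ← volOp_apply_eq_pregenerator G σ A f hf] at h4
    exact h4.le
  · exact ((integrable_continuousMap _ ⟨_, hP.feller _ f⟩).sub
      (integrable_continuousMap _ f)).div_const _
  · exact integrable_continuousMap _ _

theorem IsSignedVoterModel.hasDerivWithinAt_correlation (hP : IsSignedVoterModel G σ P)
    (hdeg : ∀ x, 0 < G.degree x) (η : Config V) (A : Finset V) {t : ℝ} (ht : 0 ≤ t) :
    HasDerivWithinAt (fun s => correlation P η s A) (dualGenerator G σ (correlation P η t) A)
      (Set.Ici t) t := by
  have h := hP.hasDerivWithinAt (dependsOn_spinProd A) η ht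
  rw [← expectation_apply, map_volOp_spinProd hdeg] at h
  exact h

theorem IsSignedVoterModel.truncatedCorrelation_eq (hP : IsSignedVoterModel G σ P)
    (hdeg : ∀ x, 0 < G.degree x) (η : Config V) (n : ℕ) {t : ℝ} (ht : 0 ≤ t) :
    truncatedCorrelation P η n t =
      expOp ((isSupContraction_dualStep (σ := σ) hdeg n).op - 1) ((n + 1 : ℕ) * t)
        (truncatedCorrelation P η n 0) := by
  refine eq_expOp_of_hasDerivWithinAt (fun A => evalLp A)
    (fun b c hc hb => lp.norm_le_of_forall_le hc hb) (fun A b => abs_apply_le_norm b A) _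
    (isSupContraction_dualStep hdeg n).norm_op_le (by positivity) _ (M := 1)
    (fun t => lp.norm_le_of_forall_le zero_le_one fun A => ?_) (fun A => ?_) (fun A s hs => ?_) ht
  · change |if A.card ≤ n then correlation P η t A else 0| ≤ 1
    split_ifs
    · exact abs_correlation_le η t A
    · simp
  · change ContinuousOn (fun s => if A.card ≤ n then correlation P η s A else 0) _
    split_ifs
    · exact ((hP.toIsFellerSemigroup.continuous_integral (spinProd A) η).comp
        continuous_real_toNNReal).continuousOn
    · exact continuousOn_const
  · change HasDerivWithinAt (fun s => if A.card ≤ n then correlation P η s A else 0)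
      (((n + 1 : ℕ) : ℝ) * (dualStep G σ n (truncatedCorrelation P η n s) A -
        truncatedCorrelation P η n s A)) _ _
    rw [dualStep_apply, add_sub_cancel_left]
    have hn : ((n + 1 : ℕ) : ℝ) ≠ 0 := by positivity
    split_ifs with hA
    · rw [← mul_assoc, mul_one_div_cancel hn, one_mul]
      exact (hP.hasDerivWithinAt_correlation hdeg η A hs).congr_deriv
        (dualGenerator_truncatedCorrelation η s hA).symm
    · rw [mul_zero]
      exact hasDerivWithinAt_const _ _ _

/-- The correlations are asymptotically harmonic for the annihilating walks. -/
theorem IsSignedVoterModel.tendsto_dualGenerator_correlation (hP : IsSignedVoterModel G σ P)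
    (hdeg : ∀ x, 0 < G.degree x) (η : Config V) (A : Finset V) :
    Tendsto (fun t => dualGenerator G σ (correlation P η t) A) atTop (𝓝 0) := by
  set n := A.card with hn
  have hn0 : (0 : ℝ) < ((n + 1 : ℕ) : ℝ) := by positivity
  have h1 : Tendsto (fun t : ℝ => ((n + 1 : ℕ) : ℝ) * t) atTop atTop :=
    tendsto_id.const_mul_atTop hn0
  have h2 := ((tendsto_one_div_sqrt_mul ‖truncatedCorrelation P η n 0‖).comp h1).const_mul
    ((n + 1 : ℕ) : ℝ)
  rw [mul_zero] at h2
  refine squeeze_zero_norm' ((eventually_gt_atTop (0 : ℝ)).mono fun t ht => ?_) h2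
  have h3 := norm_sub_one_expOp_le (isSupContraction_dualStep (σ := σ) hdeg n).op
    (isSupContraction_dualStep hdeg n).norm_op_le (mul_pos hn0 ht) (truncatedCorrelation P η n 0)
  rw [← hP.truncatedCorrelation_eq hdeg η n ht.le] at h3
  have h4 := (abs_apply_le_norm _ A).trans h3
  have h5 : (((isSupContraction_dualStep (σ := σ) hdeg n).op - 1) (truncatedCorrelation P η n t)
      : Finset V → ℝ) A = 1 / ((n + 1 : ℕ) : ℝ) * dualGenerator G σ (correlation P η t) A := by
    change dualStep G σ n (truncatedCorrelation P η n t) A - truncatedCorrelation P η n t A = _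
    rw [dualStep_apply, add_sub_cancel_left, if_pos hn.ge]
    exact congrArg _ (dualGenerator_truncatedCorrelation η t hn.ge)
  rw [h5, abs_mul, abs_of_nonneg (by positivity), one_div, inv_mul_le_iff₀ hn0] at h4
  exact h4

theorem IsSignedVoterModel.exists_tendsto_correlation (hP : IsSignedVoterModel G σ P)
    (hdeg : ∀ x, 0 < G.degree x) (hL : SignedLiouville G σ) (A : Finset V) :
    ∃ c, ∀ η, Tendsto (fun t : ℝ≥0 => ∫ ξ, spinProd A ξ ∂(P t η)) atTop (𝓝 c) := by
  have hlim : ∀ (η : Config V) (U : Ultrafilter ℝ), (U : Filter ℝ) ≤ atTop →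
      ∃ w : Finset V → ℝ, (∀ B, |w B| ≤ 1) ∧ w ∅ = 1 ∧ (∀ B, dualGenerator G σ w B = 0) ∧
        ∀ B, Tendsto (fun t => correlation P η t B) U (𝓝 (w B)) := by
    intro η U hU
    obtain ⟨w, hw, hwlim⟩ := exists_tendsto_ultrafilter U (correlation P η)
      (Eventually.of_forall fun t B => abs_correlation_le η t B)
    refine ⟨w, hw, ?_, fun B => ?_, hwlim⟩
    · refine tendsto_nhds_unique (hwlim ∅) (tendsto_const_nhds.congr fun t => ?_)
      simp [correlation, spinProd_apply]
    · exact tendsto_nhds_unique (tendsto_dualGenerator hwlim B)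
        ((hP.tendsto_dualGenerator_correlation hdeg η B).mono_left hU)
  obtain ⟨w, hw, hw0, hwharm, -⟩ := hlim 1 (Ultrafilter.of atTop) (Ultrafilter.of_le atTop)
  refine ⟨w A, fun η => ?_⟩
  suffices h : Tendsto (fun t : ℝ => correlation P η t A) atTop (𝓝 (w A)) by
    refine (h.comp (NNReal.tendsto_coe_atTop.2 tendsto_id)).congr fun t => ?_
    simp [correlation]
  rw [tendsto_iff_ultrafilter]
  intro U hU
  obtain ⟨w', hw', hw0', hwharm', hlim'⟩ := hlim η U hU
  have hdiff := eq_zero_of_dualGenerator_eq_zero hdeg hL (w := w' + (-1 : ℝ) • w) (C := 2)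
    (fun B => by
      have h1 := abs_le.1 (hw B)
      have h2 := abs_le.1 (hw' B)
      simp only [Pi.add_apply, Pi.smul_apply, smul_eq_mul]
      exact abs_le.2 ⟨by linarith, by linarith⟩)
    (by simp [hw0, hw0'])
    (fun B => by rw [dualGenerator_add, dualGenerator_smul, hwharm, hwharm']; simp) A
  have heq : w' A = w A := by
    simp only [Pi.add_apply, Pi.smul_apply, smul_eq_mul] at hdiff
    linarith
  rw [← heq]
  exact hlim' A

end Evolution

/-! ### Ergodicity -/

section Ergodic

variable {V : Type*}

theorem dense_span_spinProd :
    Dense (Submodule.span ℝ (Set.range (spinProd : Finset V → C(Config V, ℝ))) :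
      Set C(Config V, ℝ)) := by
  classical
  have hsep : (Algebra.adjoin ℝ (Set.range fun x : V => spinProd {x})).SeparatesPoints := by
    intro η ξ hne
    obtain ⟨x, hx⟩ := Function.ne_iff.1 hne
    refine ⟨_, ⟨spinProd {x}, Algebra.subset_adjoin ⟨x, rfl⟩, rfl⟩, ?_⟩
    simpa [spinProd_apply, Units.ext_iff] using hx
  have htop := ContinuousMap.subalgebra_topologicalClosure_eq_top_of_separatesPoints _ hsep
  have hdense : Dense (Algebra.adjoin ℝ (Set.range fun x : V => spinProd {x}) :
      Set C(Config V, ℝ)) := by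
    intro f
    have : f ∈ (Algebra.adjoin ℝ (Set.range fun x : V => spinProd {x})).topologicalClosure := by
      rw [htop]
      trivial
    exact this
  refine hdense.mono ?_
  have hclosure : (Submonoid.closure (Set.range fun x : V => spinProd {x}) :
      Set C(Config V, ℝ)) ⊆ Set.range spinProd := by
    intro f hf
    induction hf using Submonoid.closure_induction_right with
    | one =>
      refine ⟨∅, ?_⟩
      ext η
      simp [spinProd_apply]
    | mul_right f _ g hg ih =>
      obtain ⟨A, rfl⟩ := ih
      obtain ⟨y, rfl⟩ := hg
      refine ⟨symmDiff A {y}, ?_⟩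
      ext η
      rw [spinProd_symmDiff_singleton, ContinuousMap.mul_apply, mul_comm]
      simp [spinProd_apply]
  intro f hf
  have hf' : f ∈ Subalgebra.toSubmodule (Algebra.adjoin ℝ (Set.range fun x : V => spinProd {x})) :=
    hf
  rw [Algebra.adjoin_eq_span] at hf'
  exact Submodule.span_mono hclosure hf'

variable [Countable V]

theorem abs_integral_sub_le (μ : Measure (Config V)) [IsProbabilityMeasure μ]
    (f g : C(Config V, ℝ)) : |∫ ξ, f ξ ∂μ - ∫ ξ, g ξ ∂μ| ≤ ‖f - g‖ := by
  rw [← integral_sub (integrable_continuousMap μ f) (integrable_continuousMap μ g)]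
  exact abs_expectation_le μ _ fun ξ => (f - g).norm_coe_le_norm ξ

variable {P : ℝ≥0 → Kernel (Config V) (Config V)} [∀ t, IsMarkovKernel (P t)]

theorem exists_tendsto_integral
    (h : ∀ A : Finset V, ∃ c, ∀ η, Tendsto (fun t => ∫ ξ, spinProd A ξ ∂(P t η)) atTop (𝓝 c))
    (f : C(Config V, ℝ)) : ∃ c, ∀ η, Tendsto (fun t => ∫ ξ, f ξ ∂(P t η)) atTop (𝓝 c) := by
  have hspan : ∀ g ∈ Submodule.span ℝ (Set.range (spinProd : Finset V → C(Config V, ℝ))),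
      ∃ c, ∀ η, Tendsto (fun t => expectation (P t η) g) atTop (𝓝 c) := by
    intro g hg
    induction hg using Submodule.span_induction with
    | mem g hg =>
      obtain ⟨A, rfl⟩ := hg
      exact h A
    | zero => exact ⟨0, fun η => by simp⟩
    | add g g' _ _ ih ih' =>
      obtain ⟨c, hc⟩ := ih
      obtain ⟨c', hc'⟩ := ih'
      exact ⟨c + c', fun η => by simpa only [map_add] using (hc η).add (hc' η)⟩
    | smul r g _ ih =>
      obtain ⟨c, hc⟩ := ih
      exact ⟨r * c, fun η => by simpa only [map_smul, smul_eq_mul] using (hc η).const_mul r⟩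
  have happrox : ∀ ε > 0, ∃ g c, ‖f - g‖ < ε ∧
      ∀ η, Tendsto (fun t => ∫ ξ, g ξ ∂(P t η)) atTop (𝓝 c) := by
    intro ε hε
    obtain ⟨g, hg, hfg⟩ := Metric.dense_iff.1 dense_span_spinProd f ε hε
    obtain ⟨c, hc⟩ := hspan g hfg
    refine ⟨g, c, ?_, hc⟩
    rwa [Metric.mem_ball, dist_comm, dist_eq_norm] at hg
  obtain ⟨c, hc⟩ : ∃ c, Tendsto (fun t => ∫ ξ, f ξ ∂(P t 1)) atTop (𝓝 c) := by
    refine cauchySeq_tendsto_of_complete (Metric.cauchySeq_iff'.2 fun ε hε => ?_)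
    obtain ⟨g, c, hfg, hg⟩ := happrox (ε / 3) (by positivity)
    obtain ⟨N, hN⟩ := Metric.cauchySeq_iff'.1 (hg 1).cauchySeq (ε / 3) (by positivity)
    refine ⟨N, fun n hn => ?_⟩
    have h1 := abs_integral_sub_le (P n 1) f g
    have h2 := abs_integral_sub_le (P N 1) f g
    have h3 := hN n hn
    rw [abs_sub_comm] at h2
    rw [← Real.dist_eq] at h1 h2
    have := dist_triangle4 (∫ ξ, f ξ ∂(P n 1)) (∫ ξ, g ξ ∂(P n 1)) (∫ ξ, g ξ ∂(P N 1))
      (∫ ξ, f ξ ∂(P N 1))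
    linarith
  refine ⟨c, fun η => Metric.tendsto_nhds.2 fun ε hε => ?_⟩
  obtain ⟨g, d, hfg, hg⟩ := happrox (ε / 3) (by positivity)
  have hdc : |c - d| ≤ ‖f - g‖ :=
    le_of_tendsto (hc.sub (hg 1)).abs (Eventually.of_forall fun t => abs_integral_sub_le _ f g)
  filter_upwards [Metric.tendsto_nhds.1 (hg η) (ε / 3) (by positivity)] with t ht
  have h1 := abs_integral_sub_le (P t η) f g
  rw [abs_sub_comm] at hdc
  rw [← Real.dist_eq] at h1 hdc
  have := dist_triangle4 (∫ ξ, f ξ ∂(P t η)) (∫ ξ, g ξ ∂(P t η)) d c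
  linarith

theorem IsFellerSemigroup.isErgodic (hP : IsFellerSemigroup P)
    (h : ∀ f : C(Config V, ℝ), ∃ c, ∀ η, Tendsto (fun t => ∫ ξ, f ξ ∂(P t η)) atTop (𝓝 c)) :
    IsErgodic P := by
  choose Λ hΛ using h
  obtain ⟨μ, hμ, hμΛ⟩ := exists_measure
    { toFun := Λ
      map_add' := fun f g => tendsto_nhds_unique (hΛ (f + g) 1) (by
        simpa only [← expectation_apply, map_add] using (hΛ f 1).add (hΛ g 1))
      map_smul' := fun c f => tendsto_nhds_unique (hΛ (c • f) 1) (by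
        simpa only [← expectation_apply, map_smul, smul_eq_mul, RingHom.id_apply] using
          (hΛ f 1).const_mul c) }
    (fun f hf => ge_of_tendsto (hΛ f 1) (Eventually.of_forall fun t =>
      integral_nonneg fun ξ => hf ξ))
    (tendsto_nhds_unique (hΛ 1 1) (by simp))
  replace hμΛ : ∀ f : C(Config V, ℝ), ∫ ξ, f ξ ∂μ = Λ f := hμΛ
  have hbind : ∀ (ν : Measure (Config V)) [IsProbabilityMeasure ν] (t : ℝ≥0) (f : C(Config V, ℝ)),
      ∫ ξ, f ξ ∂(ν.bind (P t)) = ∫ η, ∫ ξ, f ξ ∂(P t η) ∂ν := by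
    intro ν _ t f
    exact Kernel.integral_comp (κ := Kernel.const Unit ν) (η := P t) (a := ())
      (integrable_continuousMap _ f)
  refine ⟨⟨μ, hμ⟩, fun t => ?_, fun ν hν => ?_, fun η => ?_⟩
  · change μ.bind (P t) = μ
    refine measure_ext_of_continuousMap fun f => ?_
    have h1 : ∫ ξ, (⟨_, hP.feller t f⟩ : C(Config V, ℝ)) ξ ∂μ = Λ f := by
      rw [hμΛ]
      refine tendsto_nhds_unique (hΛ _ 1) ?_
      refine ((hΛ f 1).comp (tendsto_atTop_mono (fun s => le_self_add (b := t))
        tendsto_id)).congr fun s => ?_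
      exact hP.integral_add s t f 1
    rw [hbind, hμΛ, ← h1]
    rfl
  · refine Subtype.ext (measure_ext_of_continuousMap (μ := (ν : Measure (Config V))) (ν := μ)
      fun f => ?_)
    rw [hμΛ]
    have h1 : Tendsto (fun t => ∫ η, ∫ ξ, f ξ ∂(P t η) ∂(ν : Measure (Config V))) atTop
        (𝓝 (∫ _, Λ f ∂(ν : Measure (Config V)))) :=
      tendsto_integral_filter_of_dominated_convergence (fun _ => ‖f‖)
        (Eventually.of_forall fun t => (hP.feller t f).aestronglyMeasurable)
        (Eventually.of_forall fun t => Eventually.of_forall fun η =>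
          abs_expectation_le _ _ fun ξ => f.norm_coe_le_norm ξ)
        (integrable_const _) (Eventually.of_forall fun η => hΛ f η)
    rw [integral_const, probReal_univ, one_smul] at h1
    refine tendsto_nhds_unique (tendsto_const_nhds.congr fun t => ?_) h1
    rw [← hbind]
    congr 1
    exact (hν t).symm
  · refine ProbabilityMeasure.tendsto_iff_forall_integral_tendsto.2 fun f => ?_
    have h1 := hΛ f.toContinuousMap η
    rw [← hμΛ] at h1
    exact h1

end Ergodic

end SignedVoter

end

theorem mainTheorem6 {V : Type*} [Countable V] [DecidableEq V]
    [MeasurableSpace V] [DiscreteMeasurableSpace V]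
    (G : SimpleGraph V) [G.LocallyFinite] (σ : Sym2 V → ℤˣ)
    (hG : ∀ x, ∀ᵐ ω ∂(SignedVoter.walkLaw G x),
      SignedVoter.TraversesInfinitelyManyUnsatisfiedCycles G σ (SignedVoter.walkPath ω))
    (P : ℝ≥0 → Kernel (SignedVoter.Config V) (SignedVoter.Config V)) [∀ t, IsMarkovKernel (P t)]
    (hP : SignedVoter.IsSignedVoterModel G σ P) :
    SignedVoter.IsErgodic P := by
  have hdeg : ∀ x, 0 < G.degree x := fun x => SignedVoter.degree_pos_of_traverses (hG x)
  have hL : SignedVoter.SignedLiouville G σ := fun u C hC hu =>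
    SignedVoter.eq_zero_of_signedAverage_eq G σ hdeg
      (fun x => SignedVoter.ae_hasLateUnsatisfiedCycles hdeg (hG x)) hC hu
  exact hP.toIsFellerSemigroup.isErgodic
    (SignedVoter.exists_tendsto_integral (hP.exists_tendsto_correlation hdeg hL))
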